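/- Let $(\Omega,\mathcal F,\mathbb P)$ be a probability space with expectation $\mathbb E$, and let $(g_{ij})_{1\le i<j}$ be independent standard Gaussian random variables on it. Let $\beta>0$, $\mathsf v>0$, $\mathsf b\ge 0$. For $N\ge 2$ consider on $(\mathbb C^2)^{\otimes N}$ the random Hamiltonian of the Sherrington–Kirkpatrick model with a transverse magnetic field, $$H_N=-\frac{\mathsf v}{\sqrt N}\sum_{1\le i<j\le N}g_{ij}\,S_i^{\mathrm z}S_j^{\mathrm z}-\mathsf b\sum_{i=1}^N S_i^{\mathrm x},$$ where $S_i^{\mathrm x}$ and $S_i^{\mathrm z}$ denote the Pauli matrices $\begin{bmatrix}0&1\\1&0\end{bmatrix}$ and $\begin{bmatrix}1&0\\0&-1\end{bmatrix}$ acting on the $i$-th tensor factor. Define the partition function, the free energy and the annealed free energy by $$Z_N=\operatorname{Tr}e^{-\beta H_N},\qquad f_N=-\frac1{\beta N}\ln Z_N,\qquad f_N^{\mathrm{ann}}=-\frac1{\beta N}\ln\mathbb E[Z_N],$$ and put $\lambda=\beta^2\mathsf v^2/4$. If $4\lambda<1$ (equivalently, $\beta\mathsf v<1$), then $\mathbb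 E[Z_N]<\infty$ for all $N\ge2$, the macroscopic limit $f_\infty^{\mathrm{ann}}=\lim_{N\to\infty}f_N^{\mathrm{ann}}$ of the annealed free energy exists in $\mathbb R$, and the free energy converges to it almost surely: $$\lim_{N\to\infty}f_N=\lim_{N\to\infty}f_N^{\mathrm{ann}}=f_\infty^{\mathrm{ann}}\qquad(\mathbb P\text{-almost surely}).$$ -/

import Mathlib

open MeasureTheory ProbabilityTheory Filter Topology

namespace QuantumSK

noncomputable section

/-- The Pauli matrix `S^x`, in the eigenbasis of `S^z`. -/
def pauliX : Matrix (Fin 2) (Fin 2) ℂ := !![0, 1; 1, 0]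

/-- The Pauli matrix `S^z`. -/
def pauliZ : Matrix (Fin 2) (Fin 2) ℂ := !![1, 0; 0, -1]

/-- Operators on the `N`-spin Hilbert space `(ℂ²)^{⊗N} ≅ ℂ^(2^N)`, as matrices with respect to the
product basis, which is indexed by the configurations `Fin N → Fin 2`. -/
abbrev SpinMatrix (N : ℕ) : Type := Matrix (Fin N → Fin 2) (Fin N → Fin 2) ℂ

/-- The tensor product `1 ⊗ ⋯ ⊗ 1 ⊗ A ⊗ 1 ⊗ ⋯ ⊗ 1` with `A` as its `i`-th factor: matrix elements
of a tensor product in the product basis are products of matrix elements of the factors. -/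
def siteOp {N : ℕ} (i : Fin N) (A : Matrix (Fin 2) (Fin 2) ℂ) : SpinMatrix N :=
  Matrix.of fun s t => ∏ k : Fin N, (if k = i then A else 1) (s k) (t k)

/-- The Hamiltonian
`H_N = -(v/√N) ∑_{i<j} g_{ij} S_i^z S_j^z - b ∑_i S_i^x` for given real couplings `g_{ij}`
(the sites are numbered from `0` to `N - 1`, and only the values `g i j` with `i < j` enter). -/
def hamiltonian (v b : ℝ) (N : ℕ) (g : ℕ → ℕ → ℝ) : SpinMatrix N :=
  -((v / √(N : ℝ) : ℝ) : ℂ) •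
      ∑ i : Fin N, ∑ j ∈ Finset.Ioi i, ((g i j : ℝ) : ℂ) • (siteOp i pauliZ * siteOp j pauliZ)
    - (b : ℂ) • ∑ i : Fin N, siteOp i pauliX

/-- The partition function `Z_N = Tr exp(-β H_N)`. The trace is a real number, see
`ofReal_partitionFunction`. -/
def partitionFunction (β v b : ℝ) (N : ℕ) (g : ℕ → ℕ → ℝ) : ℝ :=
  (Matrix.trace (NormedSpace.exp (-(β : ℂ) • hamiltonian v b N g))).re

/-- The free energy `f_N = -(1/(β N)) ln Z_N`. -/
def freeEnergy (β v b : ℝ) (N : ℕ) (g : ℕ → ℕ → ℝ) : ℝ :=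
  -(1 / (β * N)) * Real.log (partitionFunction β v b N g)

/-- The annealed free energy `f_N^ann = -(1/(β N)) ln E[Z_N]`, where the couplings are the random
variables `g i j` on the probability space `(Ω, P)`. -/
def annealedFreeEnergy {Ω : Type*} [MeasurableSpace Ω] (P : Measure Ω) (g : ℕ → ℕ → Ω → ℝ)
    (β v b : ℝ) (N : ℕ) : ℝ :=
  -(1 / (β * N)) *
    Real.log (∫ ω, partitionFunction β v b N (fun i j => g i j ω) ∂P)

/-- The macroscopic annealed free energy `f_∞^ann = lim_{N → ∞} f_N^ann`. -/
def macroscopicAnnealedFreeEnergy {Ω : Type*} [MeasurableSpace Ω] (P : Measure Ω)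
    (g : ℕ → ℕ → Ω → ℝ) (β v b : ℝ) : ℝ :=
  limUnder atTop (annealedFreeEnergy P g β v b)

/-- The dimensionless disorder parameter `λ = β² v² / 4`. -/
def disorderParameter (β v : ℝ) : ℝ := β ^ 2 * v ^ 2 / 4

/-- The couplings `g i j`, `i < j`, are independent standard Gaussian random variables. -/
structure IsGaussianDisorder {Ω : Type*} [MeasurableSpace Ω] (P : Measure Ω)
    (g : ℕ → ℕ → Ω → ℝ) : Prop where
  hasLaw : ∀ i j : ℕ, i < j → HasLaw (g i j) (gaussianReal 0 1) P
  indep : iIndepFun (fun p : {p : ℕ × ℕ // p.1 < p.2} => g p.1.1 p.1.2) P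

theorem siteOp_isHermitian {N : ℕ} (i : Fin N) {A : Matrix (Fin 2) (Fin 2) ℂ}
    (hA : A.IsHermitian) : (siteOp i A).IsHermitian := by
  ext s t
  simp only [siteOp, Matrix.conjTranspose_apply, Matrix.of_apply, star_prod]
  refine Finset.prod_congr rfl fun k _ => ?_
  split_ifs
  · exact hA.apply _ _
  · exact Matrix.isHermitian_one.apply _ _

theorem siteOp_pauliZ {N : ℕ} (i : Fin N) :
    siteOp i pauliZ = Matrix.diagonal fun s => pauliZ (s i) (s i) := by
  ext s t
  rw [siteOp, Matrix.of_apply, Matrix.diagonal_apply]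
  split_ifs with h
  · subst h
    rw [Finset.prod_eq_single i]
    · simp
    · intro k _ hk
      simp [hk]
    · simp
  · obtain ⟨k, hk⟩ := Function.ne_iff.1 h
    refine Finset.prod_eq_zero (Finset.mem_univ k) ?_
    split_ifs
    · revert hk
      generalize s k = x
      generalize t k = y
      fin_cases x <;> fin_cases y <;> simp [pauliZ]
    · exact Matrix.one_apply_ne hk

theorem hamiltonian_isHermitian (v b : ℝ) (N : ℕ) (g : ℕ → ℕ → ℝ) :
    (hamiltonian v b N g).IsHermitian := by
  have hx : pauliX.IsHermitian := by
    ext i j; fin_cases i <;> fin_cases j <;> simp [pauliX]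
  have hz : pauliZ.IsHermitian := by
    ext i j; fin_cases i <;> fin_cases j <;> simp [pauliZ]
  have hsx : ∀ i : Fin N, (siteOp i pauliX).conjTranspose = siteOp i pauliX :=
    fun i => siteOp_isHermitian i hx
  have hsz : ∀ i : Fin N, (siteOp i pauliZ).conjTranspose = siteOp i pauliZ :=
    fun i => siteOp_isHermitian i hz
  have hcomm : ∀ i j : Fin N,
      siteOp j pauliZ * siteOp i pauliZ = siteOp i pauliZ * siteOp j pauliZ := by
    intro i j
    simp only [siteOp_pauliZ, Matrix.diagonal_mul_diagonal, mul_comm]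
  simp [Matrix.IsHermitian, hamiltonian, Matrix.conjTranspose_sub, Matrix.conjTranspose_smul,
    Matrix.conjTranspose_sum, Matrix.conjTranspose_mul, hsx, hsz, hcomm]

/-- The trace of the Boltzmann-Gibbs operator is real. -/
theorem ofReal_partitionFunction (β v b : ℝ) (N : ℕ) (g : ℕ → ℕ → ℝ) :
    (partitionFunction β v b N g : ℂ) =
      Matrix.trace (NormedSpace.exp (-(β : ℂ) • hamiltonian v b N g)) := by
  have h : (-(β : ℂ) • hamiltonian v b N g).IsHermitian := by
    simp [Matrix.IsHermitian, Matrix.conjTranspose_smul,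
      (hamiltonian_isHermitian v b N g).eq]
  have h2 := congrArg Matrix.trace h.exp.eq
  rw [Matrix.trace_conjTranspose] at h2
  exact Complex.conj_eq_iff_re.1 h2

end

end QuantumSK

/-!
The free energy is self-averaging and its annealed version has a limit; the two limits agree as long
as the second moment of the partition function stays comparable to the square of the first.

*Path representation.* By the Lie–Trotter formula (`tendsto_pow_exp_of_tendsto`), `Z_N` is the limit,
as the number of time steps grows, of partition functions of `N` classical spins. The state of such a
spin is a closed `±1`-valued path in discrete time, the a priori weight of a path is a product of
matrix elements of `exp(h S^x)`, which are nonnegative, and the pair `i < j` interacts through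
`g_ij` times the time average of the product of the two paths. All inequalities are proved for these
finite sums, for the abstract `SpinEnsemble`, and are inherited by `Z_N` in the limit.

*Annealed limit.* Integrating out the couplings gives, up to the factor `exp(-λ)`, the exponential of
`N` times a convex function of the empirical measure of the paths. Hence `exp(λ) E[Z_N]` is
submultiplicative (`SpinEnsemble.exp_mul_annealed_add_le`) and Fekete's lemma applies.

*Second moment.* In `E[Z_N²]` two replicas `σ`, `τ` interact through the time averages of
`exp((2λ/N) (∑ᵢ σᵢ(t) τᵢ(t'))²)` after an application of Jensen's inequality. The annealed weight is
invariant under reversing the sign of the path at any single site, so that for fixed times `t`, `t'`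
the products `σᵢ(t) τᵢ(t')` are independent fair signs. The exponential moment of the square of
their normalised sum is bounded uniformly in `N` exactly when `4λ < 1`
(`sum_exp_sq_rademacher_le`), so that `E[Z_N²] ≤ C E[Z_N]²` (`SpinEnsemble.sum_sum_exp_le`).

*Concentration.* `ln Z_N` is Lipschitz with constant `βv/√N` in each of its fewer than `N²` Gaussian
couplings, so its deviations of order `N` from its mean are exponentially unlikely
(`measureReal_abs_sub_integral_le`). Together with the second moment bound this forces
`E[ln Z_N]` and `ln E[Z_N]` to differ by `o(N)` (`integral_le_two_mul_of_sq_le`), and the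
Borel–Cantelli lemma gives the almost sure convergence.
-/

namespace QuantumSK

/-! ### Path representation of the partition function -/

theorem norm_pow_sub_pow_le_of_norm_le {𝔸 : Type*} [NormedRing 𝔸] [NormOneClass 𝔸] {S T : 𝔸} {M : ℝ}
    (hM : 1 ≤ M) (hS : ‖S‖ ≤ M) (hT : ‖T‖ ≤ M) (n : ℕ) :
    ‖S ^ n - T ^ n‖ ≤ n * M ^ n * ‖S - T‖ := by
  induction n with
  | zero => simp
  | succ n ih =>
    have hM0 : 0 ≤ M := zero_le_one.trans hM
    have h : S ^ (n + 1) - T ^ (n + 1) = S ^ n * (S - T) + (S ^ n - T ^ n) * T := by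
      rw [pow_succ, pow_succ]; noncomm_ring
    have h1 : ‖S ^ n‖ ≤ M ^ (n + 1) :=
      ((norm_pow_le S n).trans (pow_le_pow_left₀ (norm_nonneg _) hS n)).trans
        (pow_le_pow_right₀ hM n.le_succ)
    calc ‖S ^ (n + 1) - T ^ (n + 1)‖
        ≤ ‖S ^ n‖ * ‖S - T‖ + ‖S ^ n - T ^ n‖ * ‖T‖ := by
          rw [h]; exact (norm_add_le _ _).trans (add_le_add (norm_mul_le _ _) (norm_mul_le _ _))
      _ ≤ M ^ (n + 1) * ‖S - T‖ + (n * M ^ n * ‖S - T‖) * M := by gcongr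
      _ = (n + 1 : ℕ) * M ^ (n + 1) * ‖S - T‖ := by push_cast; ring

theorem tendsto_smul_exp_inv_smul_sub_one {𝔸 : Type*} [NormedRing 𝔸] [NormedAlgebra ℂ 𝔸]
    [CompleteSpace 𝔸] (A : 𝔸) :
    Tendsto (fun n : ℕ => (n : ℂ) • (NormedSpace.exp ((n : ℂ)⁻¹ • A) - 1)) atTop (𝓝 A) := by
  have h := (hasDerivAt_exp_smul_const (𝕂 := ℂ) A (0 : ℂ)).tendsto_slope_zero
  have h0 : Tendsto (fun n : ℕ => (n : ℂ)⁻¹) atTop (𝓝[≠] 0) := by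
    refine tendsto_nhdsWithin_iff.2 ⟨tendsto_inv_atTop_nhds_zero_nat, ?_⟩
    filter_upwards [eventually_ne_atTop 0] with n hn
    simpa using hn
  simpa [Function.comp_def] using h.comp h0

/-- Chernoff's form of the Lie–Trotter product formula: only the first-order behaviour of the
factors `S n` matters. -/
theorem tendsto_pow_exp_of_tendsto {𝔸 : Type*} [NormedRing 𝔸] [NormOneClass 𝔸] [NormedAlgebra ℂ 𝔸]
    [CompleteSpace 𝔸] {S : ℕ → 𝔸} {A : 𝔸}
    (hS : Tendsto (fun n : ℕ => (n : ℂ) • (S n - 1)) atTop (𝓝 A)) :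
    Tendsto (fun n => S n ^ n) atTop (𝓝 (NormedSpace.exp A)) := by
  set T : ℕ → 𝔸 := fun n => NormedSpace.exp ((n : ℂ)⁻¹ • A) with hTdef
  have hT : Tendsto (fun n : ℕ => (n : ℂ) • (T n - 1)) atTop (𝓝 A) :=
    tendsto_smul_exp_inv_smul_sub_one A
  have hTn : ∀ᶠ n : ℕ in atTop, T n ^ n = NormedSpace.exp A := by
    filter_upwards [eventually_ne_atTop 0] with n hn
    rw [hTdef]
    let _ : NormedAlgebra ℚ 𝔸 := NormedAlgebra.restrictScalars ℚ ℂ 𝔸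
    simp only
    rw [← NormedSpace.exp_nsmul, ← Nat.cast_smul_eq_nsmul ℂ, smul_smul,
      mul_inv_cancel₀ (Nat.cast_ne_zero.2 hn), one_smul]
  have hd : Tendsto (fun n : ℕ => ‖(n : ℂ) • (S n - T n)‖) atTop (𝓝 0) := by
    have := (hS.sub hT).norm
    simpa [← smul_sub] using this
  have key : ∀ {U : ℕ → 𝔸}, Tendsto (fun n : ℕ => (n : ℂ) • (U n - 1)) atTop (𝓝 A) →
      ∀ᶠ n : ℕ in atTop, ‖U n‖ ≤ 1 + (‖A‖ + 1) / n := by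
    intro U hU
    filter_upwards [hU.norm.eventually (gt_mem_nhds (lt_add_one ‖A‖)), eventually_gt_atTop 0]
      with n h1 hn
    have hn' : (0 : ℝ) < n := Nat.cast_pos.2 hn
    rw [norm_smul, Complex.norm_natCast] at h1
    have h2 : ‖U n - 1‖ ≤ (‖A‖ + 1) / n := by rw [le_div_iff₀ hn', mul_comm]; exact h1.le
    calc ‖U n‖ = ‖1 + (U n - 1)‖ := by congr 1; abel
      _ ≤ ‖(1 : 𝔸)‖ + ‖U n - 1‖ := norm_add_le _ _
      _ ≤ _ := by rw [norm_one]; gcongr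
  have hlim : Tendsto (fun n => S n ^ n - T n ^ n) atTop (𝓝 0) := by
    rw [tendsto_zero_iff_norm_tendsto_zero]
    refine squeeze_zero' (Eventually.of_forall fun _ => norm_nonneg _)
      (g := fun n : ℕ => Real.exp (‖A‖ + 1) * ‖(n : ℂ) • (S n - T n)‖) ?_
      (by simpa using hd.const_mul (Real.exp (‖A‖ + 1)))
    filter_upwards [key hS, key hT, eventually_gt_atTop 0] with n h1 h2 hn
    have hn' : (0 : ℝ) < n := Nat.cast_pos.2 hn
    have hK : 0 ≤ (‖A‖ + 1) / n := by positivity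
    have hM : (1 + (‖A‖ + 1) / n) ^ n ≤ Real.exp (‖A‖ + 1) := by
      calc (1 + (‖A‖ + 1) / n) ^ n ≤ (Real.exp ((‖A‖ + 1) / n)) ^ n := by
            gcongr; rw [add_comm]; exact Real.add_one_le_exp _
        _ = _ := by rw [← Real.exp_nat_mul]; congr 1; field_simp
    calc ‖S n ^ n - T n ^ n‖ ≤ n * (1 + (‖A‖ + 1) / n) ^ n * ‖S n - T n‖ :=
          norm_pow_sub_pow_le_of_norm_le (by linarith) h1 h2 n
      _ ≤ n * Real.exp (‖A‖ + 1) * ‖S n - T n‖ := by gcongr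
      _ = _ := by rw [norm_smul, Complex.norm_natCast]; ring
  have h3 := hlim.add (tendsto_const_nhds.congr' (hTn.mono fun n h => h.symm))
  simpa using h3

/-- The entries of a matrix power are sums over discrete-time paths. -/
theorem pow_apply_eq_sum_paths {S R : Type*} [Fintype S] [DecidableEq S] [CommSemiring R]
    (A : Matrix S S R) (n : ℕ) (s t : S) :
    (A ^ n) s t = ∑ p : Fin (n + 1) → S, if p 0 = s ∧ p (Fin.last n) = t then
      ∏ k : Fin n, A (p k.castSucc) (p k.succ) else 0 := by
  induction n generalizing s with
  | zero =>
    rw [pow_zero, Matrix.one_apply, ← (Equiv.funUnique (Fin 1) S).symm.sum_comp]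
    simp [ite_and]
  | succ n ih =>
    rw [pow_succ', Matrix.mul_apply, ← (Fin.consEquiv fun _ : Fin (n + 2) => S).sum_comp,
      Fintype.sum_prod_type]
    simp only [ih, Finset.mul_sum]
    rw [Finset.sum_comm, Finset.sum_comm (s := Finset.univ (α := S))]
    refine Finset.sum_congr rfl fun q _ => ?_
    simp [Fin.consEquiv, Fin.prod_univ_succ, ← Fin.succ_last, ite_and]

theorem trace_pow_eq_sum_paths {S R : Type*} [Fintype S] [DecidableEq S] [CommSemiring R]
    (A : Matrix S S R) (n : ℕ) :
    (A ^ n).trace = ∑ p : Fin (n + 1) → S, if p 0 = p (Fin.last n) then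
      ∏ k : Fin n, A (p k.castSucc) (p k.succ) else 0 := by
  simp only [Matrix.trace, Matrix.diag_apply, pow_apply_eq_sum_paths]
  rw [Finset.sum_comm]
  refine Finset.sum_congr rfl fun p _ => ?_
  simp only [ite_and, Finset.sum_ite_eq, Finset.mem_univ, if_true]
  simp only [eq_comm]

/-- The value `±1` of a classical spin, that is, the diagonal of the Pauli matrix `S^z`. -/
def spinSign : Fin 2 → ℝ := ![1, -1]

theorem spinSign_eq_or (x : Fin 2) : spinSign x = 1 ∨ spinSign x = -1 := by
  fin_cases x <;> simp [spinSign]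

theorem pauliZ_diag (x : Fin 2) : pauliZ x x = (spinSign x : ℂ) := by
  fin_cases x <;> simp [pauliZ, spinSign]

/-- The matrix `exp(h S^x)`. -/
noncomputable def hopping (h : ℝ) : Matrix (Fin 2) (Fin 2) ℝ :=
  !![Real.cosh h, Real.sinh h; Real.sinh h, Real.cosh h]

theorem hopping_zero : hopping 0 = 1 := by
  ext i j; fin_cases i <;> fin_cases j <;> simp [hopping]

theorem hopping_add (h k : ℝ) : hopping (h + k) = hopping h * hopping k := by
  ext i j
  fin_cases i <;> fin_cases j <;>
    simp [hopping, Matrix.mul_apply, Fin.sum_univ_two, Real.cosh_add, Real.sinh_add] <;> ring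

theorem hopping_pow (h : ℝ) (n : ℕ) : hopping h ^ n = hopping (n * h) := by
  induction n with
  | zero => simp [hopping_zero]
  | succ n ih => rw [pow_succ, ih, ← hopping_add]; congr 1; push_cast; ring

theorem hopping_nonneg {h : ℝ} (hh : 0 ≤ h) (i j : Fin 2) : 0 ≤ hopping h i j := by
  have h1 := (Real.cosh_pos h).le
  have h2 := Real.sinh_nonneg_iff.2 hh
  fin_cases i <;> fin_cases j <;> simpa [hopping]

theorem hopping_rev (h : ℝ) (i j : Fin 2) : hopping h i.rev j.rev = hopping h i j := by
  fin_cases i <;> fin_cases j <;> simp [hopping, Fin.rev]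

theorem hasDerivAt_hopping (h : ℝ) (i j : Fin 2) :
    HasDerivAt (fun t : ℝ => hopping (t * h) i j) (h * (pauliX i j).re) 0 := by
  have hm : HasDerivAt (fun t : ℝ => t * h) h 0 := by
    simpa using (hasDerivAt_id (0 : ℝ)).mul_const h
  have h1 : HasDerivAt (fun t : ℝ => Real.cosh (t * h)) 0 0 := by
    simpa using hm.cosh
  have h2 : HasDerivAt (fun t : ℝ => Real.sinh (t * h)) h 0 := by
    simpa using hm.sinh
  fin_cases i <;> fin_cases j <;> simp [hopping, pauliX] <;> assumption

/-- The factor `exp(t D) exp(t h ∑ i, S_i^x)` of the Trotter product, with `D` the diagonal matrix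
with entries `d`. -/
noncomputable def trotterStep {N : ℕ} (d : (Fin N → Fin 2) → ℝ) (h t : ℝ) :
    Matrix (Fin N → Fin 2) (Fin N → Fin 2) ℝ :=
  Matrix.of fun s s' => Real.exp (t * d s) * ∏ i, hopping (t * h) (s i) (s' i)

theorem prod_one_apply {N : ℕ} (s t : Fin N → Fin 2) :
    ∏ i, (1 : Matrix (Fin 2) (Fin 2) ℝ) (s i) (t i) = (1 : Matrix _ _ ℝ) s t := by
  simp only [Matrix.one_apply, Finset.prod_ite_zero, Finset.prod_const_one, Finset.mem_univ,
    true_imp_iff, funext_iff]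

/-- The Trotter factors agree to first order with the exponential of the Hamiltonian. -/
theorem hasDerivAt_trotterStep {N : ℕ} (d : (Fin N → Fin 2) → ℝ) (h : ℝ) (s s' : Fin N → Fin 2) :
    HasDerivAt (fun t => (trotterStep d h t s s' : ℂ))
      ((Matrix.diagonal (fun s => (d s : ℂ)) + (h : ℂ) • ∑ i : Fin N, siteOp i pauliX) s s') 0 := by
  have h1 : HasDerivAt (fun t : ℝ => Real.exp (t * d s)) (d s) 0 := by
    simpa using ((hasDerivAt_id (0 : ℝ)).mul_const (d s)).exp
  have h2 := HasDerivAt.fun_finsetProd (u := Finset.univ) (x := (0 : ℝ))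
    (f := fun i t => hopping (t * h) (s i) (s' i)) (fun i _ => hasDerivAt_hopping h (s i) (s' i))
  have h3 := (h1.mul h2).ofReal_comp
  refine h3.congr_deriv ?_
  simp only [zero_mul, Real.exp_zero, hopping_zero, prod_one_apply, one_mul, Matrix.add_apply,
    Matrix.smul_apply, Matrix.sum_apply, smul_eq_mul, Complex.ofReal_add, Complex.ofReal_sum]
  congr 1
  · simp only [Matrix.diagonal_apply, Matrix.one_apply]
    split_ifs <;> simp
  · rw [Finset.mul_sum]
    refine Finset.sum_congr rfl fun i _ => ?_
    have hX : ∀ x y : Fin 2, (((pauliX x y).re : ℝ) : ℂ) = pauliX x y := by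
      intro x y; fin_cases x <;> fin_cases y <;> simp [pauliX]
    rw [siteOp, Matrix.of_apply, ← Finset.mul_prod_erase _ _ (Finset.mem_univ i), if_pos rfl]
    rw [Complex.ofReal_mul, Complex.ofReal_mul, hX, Complex.ofReal_prod, mul_comm, mul_assoc]
    congr 2
    refine Finset.prod_congr rfl fun k hk => ?_
    rw [if_neg (Finset.ne_of_mem_erase hk)]
    simp only [Matrix.one_apply]
    split_ifs <;> simp

theorem trotterStep_zero {N : ℕ} (d : (Fin N → Fin 2) → ℝ) (h : ℝ) : trotterStep d h 0 = 1 := by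
  ext s s'
  simp [trotterStep, hopping_zero, prod_one_apply]

theorem tendsto_trotterStep_pow {N : ℕ} (d : (Fin N → Fin 2) → ℝ) (h : ℝ) :
    Tendsto (fun n : ℕ => ((trotterStep d h (n : ℝ)⁻¹).map ((↑) : ℝ → ℂ)) ^ n) atTop
      (𝓝 (NormedSpace.exp
        (Matrix.diagonal (fun s => (d s : ℂ)) + (h : ℂ) • ∑ i : Fin N, siteOp i pauliX))) := by
  let _ : NormedRing (SpinMatrix N) := Matrix.linftyOpNormedRing
  let _ : NormedAlgebra ℂ (SpinMatrix N) := Matrix.linftyOpNormedAlgebra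
  have : NormOneClass (SpinMatrix N) := Matrix.linfty_opNormOneClass
  refine tendsto_pow_exp_of_tendsto ?_
  refine tendsto_pi_nhds.2 fun s => tendsto_pi_nhds.2 fun s' => ?_
  have h0 : Tendsto (fun n : ℕ => (n : ℝ)⁻¹) atTop (𝓝[≠] 0) := by
    refine tendsto_nhdsWithin_iff.2 ⟨tendsto_inv_atTop_nhds_zero_nat, ?_⟩
    filter_upwards [eventually_ne_atTop 0] with n hn
    simpa using hn
  have := (hasDerivAt_trotterStep d h s s').tendsto_slope_zero.comp h0
  refine this.congr fun n => ?_
  simp only [Function.comp_apply, zero_add, inv_inv, trotterStep_zero, Matrix.smul_apply,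
    Matrix.sub_apply, Matrix.map_apply, Matrix.one_apply]
  split_ifs <;> simp

/-- The Ising energy `∑_{i<j} g_ij s_i s_j` of a classical spin configuration. -/
noncomputable def isingSum {N : ℕ} (g : ℕ → ℕ → ℝ) (s : Fin N → Fin 2) : ℝ :=
  ∑ i : Fin N, ∑ j ∈ Finset.Ioi i, g i j * (spinSign (s i) * spinSign (s j))

theorem neg_smul_hamiltonian (β v b : ℝ) (N : ℕ) (g : ℕ → ℕ → ℝ) :
    -(β : ℂ) • hamiltonian v b N g =
      Matrix.diagonal (fun s => ((β * v / √N * isingSum g s : ℝ) : ℂ)) +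
        ((β * b : ℝ) : ℂ) • ∑ i : Fin N, siteOp i pauliX := by
  have hz : ∑ i : Fin N, ∑ j ∈ Finset.Ioi i, ((g i j : ℝ) : ℂ) • (siteOp i pauliZ * siteOp j pauliZ)
      = Matrix.diagonal fun s => (isingSum g s : ℂ) := by
    ext s t
    simp only [siteOp_pauliZ, Matrix.diagonal_mul_diagonal, Matrix.sum_apply, Matrix.smul_apply,
      Matrix.diagonal_apply, pauliZ_diag, isingSum]
    split_ifs <;> simp
  rw [hamiltonian, hz, smul_sub, smul_smul, smul_smul, sub_eq_add_neg]
  congr 1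
  · ext s t
    simp only [Matrix.smul_apply, Matrix.diagonal_apply]
    split_ifs
    · push_cast; simp only [smul_eq_mul]; ring
    · simp
  · rw [← neg_smul]; congr 1; push_cast; ring

theorem tendsto_trace_trotterStep_pow (β v b : ℝ) (N : ℕ) (g : ℕ → ℕ → ℝ) :
    Tendsto (fun n : ℕ =>
        ((trotterStep (fun s : Fin N → Fin 2 => β * v / √N * isingSum g s) (β * b)
          (n : ℝ)⁻¹) ^ n).trace)
      atTop (𝓝 (partitionFunction β v b N g)) := by
  have h := tendsto_trotterStep_pow (fun s : Fin N → Fin 2 => β * v / √N * isingSum g s) (β * b)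
  rw [← neg_smul_hamiltonian] at h
  have hc : Continuous fun A : SpinMatrix N => (Matrix.trace A).re :=
    Complex.continuous_re.comp (continuous_id.matrix_trace)
  refine ((hc.tendsto _).comp h).congr fun n => ?_
  have : ∀ A : Matrix (Fin N → Fin 2) (Fin N → Fin 2) ℝ,
      (A.map ((↑) : ℝ → ℂ)) ^ n = (A ^ n).map ((↑) : ℝ → ℂ) :=
    fun A => (map_pow (Complex.ofRealHom.mapMatrix) A n).symm
  simp only [Function.comp_apply, this]
  simp [Matrix.trace]

/-- The weight of a single-site path: closed paths contribute the product of their hopping matrix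
elements. -/
noncomputable def pathWeight (h : ℝ) (n : ℕ) (q : Fin (n + 1) → Fin 2) : ℝ :=
  if q 0 = q (Fin.last n) then ∏ k : Fin n, hopping ((n : ℝ)⁻¹ * h) (q k.castSucc) (q k.succ) else 0

theorem trace_trotterStep_pow {N : ℕ} (d : (Fin N → Fin 2) → ℝ) (h : ℝ) (n : ℕ) :
    ((trotterStep d h (n : ℝ)⁻¹) ^ n).trace = ∑ σ : Fin N → Fin (n + 1) → Fin 2,
      (∏ i, pathWeight h n (σ i)) *
        Real.exp ((n : ℝ)⁻¹ * ∑ k : Fin n, d fun i => σ i k.castSucc) := by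
  rw [trace_pow_eq_sum_paths,
    ← (Equiv.piComm fun (_ : Fin N) (_ : Fin (n + 1)) => Fin 2).sum_comp]
  refine Finset.sum_congr rfl fun σ _ => ?_
  simp only [Equiv.piComm_apply, Function.swap, funext_iff, trotterStep, Matrix.of_apply, pathWeight,
    Finset.prod_ite_zero, Finset.mem_univ, true_imp_iff, Finset.prod_mul_distrib, Finset.mul_sum,
    Real.exp_sum]
  split_ifs
  · rw [mul_comm, Finset.prod_comm]
    rfl
  · simp

theorem sum_pathWeight (h : ℝ) {n : ℕ} (hn : n ≠ 0) :
    ∑ q, pathWeight h n q = 2 * Real.cosh h := by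
  have := trace_pow_eq_sum_paths (hopping ((n : ℝ)⁻¹ * h)) n
  rw [hopping_pow, mul_inv_cancel_left₀ (Nat.cast_ne_zero.2 hn)] at this
  simp only [pathWeight]
  rw [← this]
  simp [hopping, Matrix.trace, Fin.sum_univ_two]
  ring

/-! ### Gaussian integrals -/

theorem integral_exp_mul_gaussian (t : ℝ) :
    ∫ x, Real.exp (t * x) ∂(gaussianReal 0 1) = Real.exp (t ^ 2 / 2) := by
  have := mgf_gaussianReal (p := gaussianReal 0 1) (X := id) (μ := 0) (v := 1) (by simp) t
  simpa [mgf] using this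

/-- The standard Gaussian measure on `ℝ^ι`. -/
noncomputable abbrev stdGaussian (ι : Type*) [Fintype ι] : Measure (ι → ℝ) :=
  Measure.pi fun _ => gaussianReal 0 1

theorem integrable_exp_sum_stdGaussian {ι : Type*} [Fintype ι] (a : ι → ℝ) :
    Integrable (fun x : ι → ℝ => Real.exp (∑ i, a i * x i)) (stdGaussian ι) := by
  simp only [Real.exp_sum]
  exact Integrable.fintype_prod fun i => integrable_exp_mul_gaussianReal (a i)

theorem integral_exp_sum_stdGaussian {ι : Type*} [Fintype ι] (a : ι → ℝ) :
    ∫ x, Real.exp (∑ i, a i * x i) ∂(stdGaussian ι) = Real.exp (2⁻¹ * ∑ i, a i ^ 2) := by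
  simp only [Real.exp_sum, Finset.mul_sum]
  rw [integral_fintype_prod_eq_prod (f := fun i x => Real.exp (a i * x))]
  simp only [integral_exp_mul_gaussian]
  refine Finset.prod_congr rfl fun i _ => ?_
  congr 1; ring

theorem integrable_exp_sum_abs_stdGaussian {ι : Type*} [Fintype ι] (c : ℝ) :
    Integrable (fun x : ι → ℝ => Real.exp (c * ∑ i, |x i|)) (stdGaussian ι) := by
  simp only [Finset.mul_sum, Real.exp_sum]
  exact Integrable.fintype_prod fun i =>
    integrable_exp_mul_abs (integrable_exp_mul_gaussianReal c)
      (integrable_exp_mul_gaussianReal (-c))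

theorem integrable_exp_mul_sq_gaussian {a : ℝ} (ha : 2 * a < 1) :
    Integrable (fun x => Real.exp (a * x ^ 2)) (gaussianReal 0 1) := by
  rw [gaussianReal_of_var_ne_zero _ one_ne_zero,
    integrable_withDensity_iff (measurable_gaussianPDF 0 1)
      (Eventually.of_forall fun _ => gaussianPDF_lt_top)]
  have h := (integrable_exp_neg_mul_sq (b := 2⁻¹ - a) (by linarith)).mul_const
    (√(2 * Real.pi * (1 : NNReal)))⁻¹
  refine h.congr (Eventually.of_forall fun x => ?_)
  simp only [toReal_gaussianPDF, gaussianPDFReal]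
  rw [mul_left_comm, mul_comm, ← Real.exp_add]
  congr 2
  simp only [NNReal.coe_one]; ring

/-- Exponential integrability of the square of a normalised Rademacher sum, by the
Hubbard–Stratonovich linearisation of the square and `cosh x ≤ exp (x² / 2)`. -/
theorem sum_exp_sq_rademacher_le {N : ℕ} (hN : N ≠ 0) {l : ℝ} (hl : 0 ≤ l) (hl' : 4 * l < 1)
    (y : Fin N → ℝ) (hy : ∀ i, y i ^ 2 = 1) :
    ∑ ε : Fin N → Fin 2, Real.exp (2 * l / N * (∑ i, spinSign (ε i) * y i) ^ 2) ≤
      2 ^ N * ∫ z, Real.exp (2 * l * z ^ 2) ∂(gaussianReal 0 1) := by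
  have hN' : (0 : ℝ) < N := by positivity
  set κ := √(4 * l / N) with hκ
  have hκ2 : κ ^ 2 = 4 * l / N := Real.sq_sqrt (by positivity)
  have h1 : ∀ ε : Fin N → Fin 2, Real.exp (2 * l / N * (∑ i, spinSign (ε i) * y i) ^ 2) =
      ∫ z, Real.exp (κ * (∑ i, spinSign (ε i) * y i) * z) ∂(gaussianReal 0 1) := by
    intro ε
    rw [integral_exp_mul_gaussian, mul_pow, hκ2]; congr 1; ring
  simp only [h1]
  rw [← integral_finsetSum _ fun ε _ => integrable_exp_mul_gaussianReal _, ← integral_const_mul]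
  refine integral_mono (integrable_finsetSum _ fun ε _ => integrable_exp_mul_gaussianReal _)
    ((integrable_exp_mul_sq_gaussian (by linarith)).const_mul _) fun z => ?_
  have h2 : ∑ ε : Fin N → Fin 2, Real.exp (κ * (∑ i, spinSign (ε i) * y i) * z) =
      ∏ i, 2 * Real.cosh (κ * y i * z) := by
    have h3 : ∀ i, 2 * Real.cosh (κ * y i * z) =
        ∑ e : Fin 2, Real.exp (κ * (spinSign e * y i) * z) := by
      intro i
      rw [Fin.sum_univ_two, Real.cosh_eq, mul_div_cancel₀ _ two_ne_zero]
      simp [spinSign]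
    simp only [h3]
    rw [Finset.prod_univ_sum, Fintype.piFinset_univ]
    refine Finset.sum_congr rfl fun ε _ => ?_
    rw [← Real.exp_sum, Finset.mul_sum, Finset.sum_mul]
  simp only [h2]
  rw [Finset.prod_mul_distrib, Finset.prod_const, Finset.card_univ, Fintype.card_fin]
  gcongr
  calc ∏ i, Real.cosh (κ * y i * z) ≤ ∏ i, Real.exp ((κ * y i * z) ^ 2 / 2) :=
        Finset.prod_le_prod (fun i _ => (Real.cosh_pos _).le) fun i _ => Real.cosh_le_exp_half_sq _
    _ = Real.exp (2 * l * z ^ 2) := by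
        rw [← Real.exp_sum]
        congr 1
        simp only [mul_pow, hκ2, hy, mul_one, Finset.sum_const, Finset.card_univ, Fintype.card_fin,
          nsmul_eq_mul]
        field_simp; ring

theorem add_sq_div_add_le {a b : ℝ} (ha : 0 < a) (hb : 0 < b) (x y : ℝ) :
    (x + y) ^ 2 / (a + b) ≤ x ^ 2 / a + y ^ 2 / b := by
  rw [div_add_div _ _ ha.ne' hb.ne', div_le_div_iff₀ (by positivity) (by positivity)]
  nlinarith [mul_nonneg (mul_pos ha hb).le (sq_nonneg (x * b - y * a)), sq_nonneg (x * b - y * a)]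

/-! ### Classical spins with an internal time -/

/-- The pairs of distinct sites, each listed once. -/
abbrev Pair (N : ℕ) : Type := {p : Fin N × Fin N // p.1 < p.2}

theorem sum_pair {N : ℕ} (f : Fin N → Fin N → ℝ) :
    ∑ p : Pair N, f p.1.1 p.1.2 = ∑ i, ∑ j ∈ Finset.Ioi i, f i j := by
  rw [← Finset.sum_subtype (p := fun p : Fin N × Fin N => p.1 < p.2)
    (Finset.univ.filter fun p : Fin N × Fin N => p.1 < p.2) (by simp) fun p => f p.1 p.2,
    Finset.sum_filter, Fintype.sum_prod_type]
  refine Finset.sum_congr rfl fun i _ => ?_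
  rw [← Finset.sum_filter]
  congr 1; ext j; simp

theorem sum_sum_eq_diag_add {N : ℕ} {f : Fin N → Fin N → ℝ} (hf : ∀ i j, f i j = f j i) :
    ∑ i, ∑ j, f i j = ∑ i, f i i + 2 * ∑ p : Pair N, f p.1.1 p.1.2 := by
  have h1 : ∀ i : Fin N, ∑ j, f i j =
      f i i + (∑ j ∈ Finset.Ioi i, f i j + ∑ j ∈ Finset.Iio i, f i j) := by
    intro i
    rw [← Finset.sum_filter_add_sum_filter_not _ (fun j => i < j)]
    have e1 : Finset.univ.filter (fun j => i < j) = Finset.Ioi i := by ext; simp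
    have e2 : Finset.univ.filter (fun j => ¬ i < j) = insert i (Finset.Iio i) := by
      ext j; simp [le_iff_eq_or_lt]
    rw [e1, e2, Finset.sum_insert (by simp)]; ring
  have h2 : ∑ i : Fin N, ∑ j ∈ Finset.Iio i, f i j = ∑ i : Fin N, ∑ j ∈ Finset.Ioi i, f i j := by
    rw [Finset.sum_comm' (t' := Finset.univ) (s' := fun j => Finset.Ioi j) (by simp)]
    simp only [fun i j => hf i j]
  simp only [h1, Finset.sum_add_distrib]
  rw [h2, sum_pair]; ring

/-- A finite single-site state space `X` with a weight, whose states are `±1`-valued paths over a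
finite time set `T`, symmetric under reversal of the sign of a path. -/
structure SpinEnsemble (T X : Type*) [Fintype T] [Fintype X] where
  /-- The weight of a path. -/
  weight : X → ℝ
  /-- The value of a path at a given time. -/
  spin : T → X → ℝ
  /-- The reversal of the sign of a path. -/
  flip : X ≃ X
  weight_nonneg : ∀ x, 0 ≤ weight x
  weight_flip : ∀ x, weight (flip x) = weight x
  spin_sq : ∀ t x, spin t x ^ 2 = 1
  spin_flip : ∀ t x, spin t (flip x) = -spin t x

namespace SpinEnsemble

variable {T X : Type*} [Fintype T] [Fintype X] (E : SpinEnsemble T X)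

/-- The time average of the product of two paths. -/
noncomputable def overlap (x y : X) : ℝ :=
  (Fintype.card T : ℝ)⁻¹ * ∑ t, E.spin t x * E.spin t y

/-- The product weight of a configuration of paths. -/
def configWeight {N : ℕ} (σ : Fin N → X) : ℝ := ∏ i, E.weight (σ i)

/-- The partition function of `N` spins with couplings `c * x p`. -/
noncomputable def partition (N : ℕ) (c : ℝ) (x : Pair N → ℝ) : ℝ :=
  ∑ σ : Fin N → X, E.configWeight σ *
    Real.exp (c * ∑ p : Pair N, x p * E.overlap (σ p.1.1) (σ p.1.2))

theorem configWeight_nonneg {N : ℕ} (σ : Fin N → X) : 0 ≤ E.configWeight σ :=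
  Finset.prod_nonneg fun _ _ => E.weight_nonneg _

theorem sum_configWeight (N : ℕ) :
    ∑ σ : Fin N → X, E.configWeight σ = (∑ x, E.weight x) ^ N :=
  (Fintype.sum_pow _ N).symm

theorem overlap_comm (x y : X) : E.overlap x y = E.overlap y x := by
  simp only [overlap, mul_comm]

theorem overlap_self [Nonempty T] (x : X) : E.overlap x x = 1 := by
  simp [overlap, ← sq, E.spin_sq]

theorem abs_overlap_le_one [Nonempty T] (x y : X) : |E.overlap x y| ≤ 1 := by
  have h : ∀ t x, |E.spin t x| = 1 := fun t x => by
    rw [← sq_eq_sq₀ (abs_nonneg _) zero_le_one, sq_abs, E.spin_sq, one_pow]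
  rw [overlap, abs_mul, abs_inv, Nat.abs_cast]
  refine (mul_le_mul_of_nonneg_left (Finset.abs_sum_le_sum_abs _ _) (by positivity)).trans ?_
  simp [abs_mul, h]

/-! #### Dependence on the couplings -/

theorem partition_nonneg (N : ℕ) (c : ℝ) (x : Pair N → ℝ) : 0 ≤ E.partition N c x :=
  Finset.sum_nonneg fun σ _ => mul_nonneg (E.configWeight_nonneg σ) (Real.exp_pos _).le

theorem partition_zero (N : ℕ) (c : ℝ) : E.partition N c 0 = (∑ x, E.weight x) ^ N := by
  simp [partition, sum_configWeight]

theorem partition_le [Nonempty T] {N : ℕ} {c : ℝ} (hc : 0 ≤ c) (x y : Pair N → ℝ) :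
    E.partition N c x ≤ Real.exp (c * ∑ p, |x p - y p|) * E.partition N c y := by
  rw [partition, partition, Finset.mul_sum]
  refine Finset.sum_le_sum fun σ _ => ?_
  rw [mul_left_comm, ← Real.exp_add, ← mul_add]
  refine mul_le_mul_of_nonneg_left (Real.exp_le_exp.2 (mul_le_mul_of_nonneg_left ?_ hc))
    (E.configWeight_nonneg σ)
  rw [← Finset.sum_add_distrib]
  refine Finset.sum_le_sum fun p _ => ?_
  have h1 := E.abs_overlap_le_one (σ p.1.1) (σ p.1.2)
  have h2 : (x p - y p) * E.overlap (σ p.1.1) (σ p.1.2) ≤ |x p - y p| :=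
    (le_abs_self _).trans (by rw [abs_mul]; exact mul_le_of_le_one_right (abs_nonneg _) h1)
  linarith

theorem continuous_partition (N : ℕ) (c : ℝ) : Continuous (E.partition N c) := by
  unfold partition; fun_prop

/-! #### Moments of the partition function -/

theorem integral_partition (N : ℕ) (c : ℝ) :
    ∫ x, E.partition N c x ∂(stdGaussian (Pair N)) = ∑ σ : Fin N → X, E.configWeight σ *
      Real.exp (2⁻¹ * c ^ 2 * ∑ p : Pair N, E.overlap (σ p.1.1) (σ p.1.2) ^ 2) := by
  have h : ∀ (σ : Fin N → X) (x : Pair N → ℝ),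
      c * ∑ p : Pair N, x p * E.overlap (σ p.1.1) (σ p.1.2) =
        ∑ p : Pair N, (c * E.overlap (σ p.1.1) (σ p.1.2)) * x p := by
    intro σ x; rw [Finset.mul_sum]; refine Finset.sum_congr rfl fun p _ => ?_; ring
  simp only [partition, h]
  rw [integral_finsetSum _ fun σ _ => (integrable_exp_sum_stdGaussian _).const_mul _]
  refine Finset.sum_congr rfl fun σ _ => ?_
  rw [integral_const_mul, integral_exp_sum_stdGaussian]
  simp only [mul_pow, ← Finset.mul_sum, mul_assoc]

theorem integral_partition_sq (N : ℕ) (c : ℝ) :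
    ∫ x, E.partition N c x ^ 2 ∂(stdGaussian (Pair N)) =
      ∑ σ : Fin N → X, ∑ τ : Fin N → X, E.configWeight σ * E.configWeight τ *
        Real.exp (2⁻¹ * c ^ 2 * ∑ p : Pair N,
          (E.overlap (σ p.1.1) (σ p.1.2) + E.overlap (τ p.1.1) (τ p.1.2)) ^ 2) := by
  have h : ∀ x : Pair N → ℝ, E.partition N c x ^ 2 =
      ∑ σ : Fin N → X, ∑ τ : Fin N → X, E.configWeight σ * E.configWeight τ *
        Real.exp (∑ p : Pair N, (c *
          (E.overlap (σ p.1.1) (σ p.1.2) + E.overlap (τ p.1.1) (τ p.1.2))) * x p) := by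
    intro x
    rw [sq, partition, Finset.sum_mul_sum]
    refine Finset.sum_congr rfl fun σ _ => Finset.sum_congr rfl fun τ _ => ?_
    rw [mul_mul_mul_comm, ← Real.exp_add, ← mul_add, ← Finset.sum_add_distrib, Finset.mul_sum]
    congr 2
    refine Finset.sum_congr rfl fun p _ => ?_
    ring
  simp only [h]
  rw [integral_finsetSum _ fun σ _ => integrable_finsetSum _ fun τ _ =>
    (integrable_exp_sum_stdGaussian _).const_mul _]
  refine Finset.sum_congr rfl fun σ _ => ?_
  rw [integral_finsetSum _ fun τ _ => (integrable_exp_sum_stdGaussian _).const_mul _]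
  refine Finset.sum_congr rfl fun τ _ => ?_
  rw [integral_const_mul, integral_exp_sum_stdGaussian]
  simp only [mul_pow, ← Finset.mul_sum, mul_assoc]

/-- The replica interaction as a time average of squared replica overlaps at fixed times. -/
theorem sum_overlap_mul_overlap {N : ℕ} (σ τ : Fin N → X) :
    ∑ i, ∑ j, E.overlap (σ i) (σ j) * E.overlap (τ i) (τ j) =
      ((Fintype.card T : ℝ)⁻¹) ^ 2 * ∑ t, ∑ t', (∑ i, E.spin t (σ i) * E.spin t' (τ i)) ^ 2 := by
  have h : ∀ i j, E.overlap (σ i) (σ j) * E.overlap (τ i) (τ j) = ((Fintype.card T : ℝ)⁻¹) ^ 2 *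
      ∑ t, ∑ t', (E.spin t (σ i) * E.spin t' (τ i)) * (E.spin t (σ j) * E.spin t' (τ j)) := by
    intro i j
    rw [overlap, overlap, mul_mul_mul_comm, ← sq, Finset.sum_mul_sum]
    congr 1
    refine Finset.sum_congr rfl fun t _ => Finset.sum_congr rfl fun t' _ => ?_
    ring
  simp only [h, ← Finset.mul_sum]
  congr 1
  simp only [sq, Finset.sum_mul_sum]
  rw [Finset.sum_congr rfl fun i _ => Finset.sum_comm, Finset.sum_comm]
  refine Finset.sum_congr rfl fun t _ => ?_
  rw [Finset.sum_congr rfl fun i _ => Finset.sum_comm, Finset.sum_comm]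

theorem two_mul_sum_pair_overlap_mul [Nonempty T] {N : ℕ} (σ τ : Fin N → X) :
    2 * ∑ p : Pair N, E.overlap (σ p.1.1) (σ p.1.2) * E.overlap (τ p.1.1) (τ p.1.2) =
      ((Fintype.card T : ℝ)⁻¹) ^ 2 * ∑ t, ∑ t', (∑ i, E.spin t (σ i) * E.spin t' (τ i)) ^ 2 - N := by
  rw [← sum_overlap_mul_overlap, sum_sum_eq_diag_add
    (f := fun i j => E.overlap (σ i) (σ j) * E.overlap (τ i) (τ j))
    (fun i j => by rw [E.overlap_comm (σ i), E.overlap_comm (τ i)])]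
  simp [overlap_self]

/-- The mean of the partition function at disorder parameter `l`, see `integral_partition`. -/
noncomputable def annealed (N : ℕ) (l : ℝ) : ℝ :=
  ∑ σ : Fin N → X, E.configWeight σ *
    Real.exp (2 * l / N * ∑ p : Pair N, E.overlap (σ p.1.1) (σ p.1.2) ^ 2)

theorem pow_le_annealed (N : ℕ) {l : ℝ} (hl : 0 ≤ l) :
    (∑ x, E.weight x) ^ N ≤ E.annealed N l := by
  rw [← sum_configWeight]
  refine Finset.sum_le_sum fun σ _ => le_mul_of_one_le_right (E.configWeight_nonneg σ) ?_
  exact Real.one_le_exp (by positivity)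

theorem exp_mul_annealed [Nonempty T] {N : ℕ} (hN : N ≠ 0) (l : ℝ) :
    Real.exp l * E.annealed N l = ∑ σ : Fin N → X, E.configWeight σ *
      Real.exp (l * ((Fintype.card T : ℝ)⁻¹) ^ 2 *
        ∑ t, ∑ t', (∑ i, E.spin t (σ i) * E.spin t' (σ i)) ^ 2 / N) := by
  rw [annealed, Finset.mul_sum]
  refine Finset.sum_congr rfl fun σ _ => ?_
  rw [mul_left_comm, ← Real.exp_add]
  congr 2
  have h := E.two_mul_sum_pair_overlap_mul σ σ
  simp only [← sq (E.overlap _ _)] at h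
  have hN' : (N : ℝ) ≠ 0 := Nat.cast_ne_zero.2 hN
  simp only [← Finset.sum_div]
  generalize ((Fintype.card T : ℝ)⁻¹) ^ 2 = w at h ⊢
  field_simp
  linear_combination l * h

/-- Submultiplicativity of the annealed partition function: the exponent is `N` times a convex
function of the empirical measure of the paths. -/
theorem exp_mul_annealed_add_le [Nonempty T] {M N : ℕ} (hM : M ≠ 0) (hN : N ≠ 0) {l : ℝ}
    (hl : 0 ≤ l) : Real.exp l * E.annealed (M + N) l ≤
      (Real.exp l * E.annealed M l) * (Real.exp l * E.annealed N l) := by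
  rw [E.exp_mul_annealed hM, E.exp_mul_annealed hN, E.exp_mul_annealed (by omega),
    ← (Fin.appendEquiv M N).sum_comp, Fintype.sum_prod_type, Finset.sum_mul_sum]
  refine Finset.sum_le_sum fun σ _ => Finset.sum_le_sum fun τ _ => ?_
  have hM' : (0 : ℝ) < M := by positivity
  have hN' : (0 : ℝ) < N := by positivity
  rw [mul_mul_mul_comm, ← Real.exp_add, ← mul_add, ← Finset.sum_add_distrib]
  simp only [Fin.appendEquiv, Equiv.coe_fn_mk, configWeight, Fin.prod_univ_add, Fin.append_left,
    Fin.append_right, Fin.sum_univ_add, ← Finset.sum_add_distrib]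
  gcongr with t _ t' _
  · exact mul_nonneg (E.configWeight_nonneg σ) (E.configWeight_nonneg τ)
  · push_cast
    exact add_sq_div_add_le hM' hN' _ _

/-- Reversal of the signs of the paths at the sites `i` with `ε i = 1`. -/
def flipAt {N : ℕ} (ε : Fin N → Fin 2) : (Fin N → X) ≃ (Fin N → X) :=
  Equiv.piCongrRight fun i => if ε i = 0 then Equiv.refl X else E.flip

theorem spin_flipAt {N : ℕ} (ε : Fin N → Fin 2) (σ : Fin N → X) (t : T) (i : Fin N) :
    E.spin t (E.flipAt ε σ i) = spinSign (ε i) * E.spin t (σ i) := by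
  simp only [flipAt, Equiv.piCongrRight_apply, Pi.map_apply]
  generalize ε i = e
  fin_cases e <;> simp [spinSign, E.spin_flip]

theorem configWeight_flipAt {N : ℕ} (ε : Fin N → Fin 2) (σ : Fin N → X) :
    E.configWeight (E.flipAt ε σ) = E.configWeight σ := by
  refine Finset.prod_congr rfl fun i _ => ?_
  simp only [flipAt, Equiv.piCongrRight_apply, Pi.map_apply]
  split_ifs <;> simp [E.weight_flip]

theorem overlap_flipAt_sq {N : ℕ} (ε : Fin N → Fin 2) (σ : Fin N → X) (i j : Fin N) :
    E.overlap (E.flipAt ε σ i) (E.flipAt ε σ j) ^ 2 = E.overlap (σ i) (σ j) ^ 2 := by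
  have h : E.overlap (E.flipAt ε σ i) (E.flipAt ε σ j) =
      (spinSign (ε i) * spinSign (ε j)) * E.overlap (σ i) (σ j) := by
    simp only [overlap, spin_flipAt, Finset.mul_sum]
    refine Finset.sum_congr rfl fun t _ => ?_
    ring
  rw [h]
  rcases spinSign_eq_or (ε i) with h1 | h1 <;> rcases spinSign_eq_or (ε j) with h2 | h2 <;>
    simp [h1, h2]

/-- Under the annealed weight the signs of the paths at different sites are independent and fair,
since the weight is invariant under sign reversal at each site separately. -/
theorem sum_annealed_exp_sq_le {N : ℕ} (hN : N ≠ 0) {l : ℝ} (hl : 0 ≤ l)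
    (hl' : 4 * l < 1) (t : T) (y : Fin N → ℝ) (hy : ∀ i, y i ^ 2 = 1) :
    ∑ σ : Fin N → X, (E.configWeight σ *
        Real.exp (2 * l / N * ∑ p : Pair N, E.overlap (σ p.1.1) (σ p.1.2) ^ 2)) *
        Real.exp (2 * l / N * (∑ i, E.spin t (σ i) * y i) ^ 2) ≤
      E.annealed N l * ∫ z, Real.exp (2 * l * z ^ 2) ∂(gaussianReal 0 1) := by
  set U : (Fin N → X) → ℝ := fun σ => E.configWeight σ *
    Real.exp (2 * l / N * ∑ p : Pair N, E.overlap (σ p.1.1) (σ p.1.2) ^ 2) with hU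
  set C := ∫ z, Real.exp (2 * l * z ^ 2) ∂(gaussianReal 0 1)
  have hU0 : ∀ σ, 0 ≤ U σ := fun σ => mul_nonneg (E.configWeight_nonneg σ) (Real.exp_pos _).le
  have hflip : ∀ ε σ, U (E.flipAt ε σ) = U σ := by
    intro ε σ
    simp only [hU, configWeight_flipAt, overlap_flipAt_sq]
  have h1 : (2 : ℝ) ^ N * ∑ σ, U σ * Real.exp (2 * l / N * (∑ i, E.spin t (σ i) * y i) ^ 2) =
      ∑ σ, U σ * ∑ ε : Fin N → Fin 2,
        Real.exp (2 * l / N * (∑ i, spinSign (ε i) * (E.spin t (σ i) * y i)) ^ 2) := by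
    calc _ = ∑ ε : Fin N → Fin 2, ∑ σ,
          U σ * Real.exp (2 * l / N * (∑ i, E.spin t (σ i) * y i) ^ 2) := by simp
      _ = ∑ ε : Fin N → Fin 2, ∑ σ, U σ *
          Real.exp (2 * l / N * (∑ i, spinSign (ε i) * (E.spin t (σ i) * y i)) ^ 2) := by
        refine Finset.sum_congr rfl fun ε _ => ?_
        rw [← (E.flipAt ε).sum_comp]
        simp only [hflip, spin_flipAt, mul_assoc]
      _ = _ := by rw [Finset.sum_comm]; simp only [Finset.mul_sum]
  have h2 : ∑ σ, U σ * ∑ ε : Fin N → Fin 2,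
        Real.exp (2 * l / N * (∑ i, spinSign (ε i) * (E.spin t (σ i) * y i)) ^ 2) ≤
      ∑ σ, U σ * (2 ^ N * C) :=
    Finset.sum_le_sum fun σ _ => mul_le_mul_of_nonneg_left
      (sum_exp_sq_rademacher_le hN hl hl' _ fun i => by rw [mul_pow, E.spin_sq, hy, one_mul]) (hU0 σ)
  rw [← h1, ← Finset.sum_mul, mul_left_comm] at h2
  exact le_of_mul_le_mul_left h2 (by positivity)

/-- The second moment is bounded by a constant multiple of the squared first moment. Jensen's
inequality removes the time averages from the interaction of the two replicas. -/
theorem sum_sum_exp_le [Nonempty T] {N : ℕ} (hN : N ≠ 0) {l : ℝ} (hl : 0 ≤ l) (hl' : 4 * l < 1) :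
    ∑ σ : Fin N → X, ∑ τ : Fin N → X, E.configWeight σ * E.configWeight τ *
        Real.exp (2 * l / N * ∑ p : Pair N,
          (E.overlap (σ p.1.1) (σ p.1.2) + E.overlap (τ p.1.1) (τ p.1.2)) ^ 2) ≤
      (∫ z, Real.exp (2 * l * z ^ 2) ∂(gaussianReal 0 1)) * E.annealed N l ^ 2 := by
  set U : (Fin N → X) → ℝ := fun σ => E.configWeight σ *
    Real.exp (2 * l / N * ∑ p : Pair N, E.overlap (σ p.1.1) (σ p.1.2) ^ 2) with hU
  set C := ∫ z, Real.exp (2 * l * z ^ 2) ∂(gaussianReal 0 1) with hC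
  have hU0 : ∀ σ, 0 ≤ U σ := fun σ => mul_nonneg (E.configWeight_nonneg σ) (Real.exp_pos _).le
  have hN' : (N : ℝ) ≠ 0 := Nat.cast_ne_zero.2 hN
  set w : ℝ := ((Fintype.card T : ℝ)⁻¹) ^ 2 with hw
  have hT : (Fintype.card T : ℝ) ≠ 0 := Nat.cast_ne_zero.2 Fintype.card_ne_zero
  have hw1 : ∑ _q : T × T, w = 1 := by
    rw [Finset.sum_const, Finset.card_univ, Fintype.card_prod, nsmul_eq_mul, hw]
    push_cast; field_simp
  have hw0 : 0 ≤ w := by positivity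
  have key : ∀ σ τ : Fin N → X, E.configWeight σ * E.configWeight τ *
      Real.exp (2 * l / N * ∑ p : Pair N,
        (E.overlap (σ p.1.1) (σ p.1.2) + E.overlap (τ p.1.1) (τ p.1.2)) ^ 2) ≤
      U σ * U τ * ∑ q : T × T,
        w * Real.exp (2 * l / N * (∑ i, E.spin q.1 (σ i) * E.spin q.2 (τ i)) ^ 2) := by
    intro σ τ
    -- The diagonal `i = j` of the double sum, absent from the interaction, accounts for `-2l`.
    have e1 : 2 * l / N * ∑ p : Pair N,
        (E.overlap (σ p.1.1) (σ p.1.2) + E.overlap (τ p.1.1) (τ p.1.2)) ^ 2 =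
        2 * l / N * ∑ p : Pair N, E.overlap (σ p.1.1) (σ p.1.2) ^ 2 +
        2 * l / N * ∑ p : Pair N, E.overlap (τ p.1.1) (τ p.1.2) ^ 2 +
        (∑ q : T × T, w * (2 * l / N * (∑ i, E.spin q.1 (σ i) * E.spin q.2 (τ i)) ^ 2)
          - 2 * l) := by
      have h := E.two_mul_sum_pair_overlap_mul σ τ
      have h' : ∑ q : T × T, w * (2 * l / N * (∑ i, E.spin q.1 (σ i) * E.spin q.2 (τ i)) ^ 2) =
          2 * l / N * (w * ∑ t, ∑ t', (∑ i, E.spin t (σ i) * E.spin t' (τ i)) ^ 2) := by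
        rw [Fintype.sum_prod_type]
        simp only [Finset.mul_sum]
        refine Finset.sum_congr rfl fun t _ => Finset.sum_congr rfl fun t' _ => ?_
        ring
      have h'' : 2 * l = 2 * l / N * N := by field_simp
      rw [h']
      simp only [add_sq, Finset.sum_add_distrib, mul_assoc, ← Finset.mul_sum]
      linear_combination 2 * l / N * h + h''
    have e2 : Real.exp (∑ q : T × T,
        w * (2 * l / N * (∑ i, E.spin q.1 (σ i) * E.spin q.2 (τ i)) ^ 2)) ≤
        ∑ q : T × T, w * Real.exp (2 * l / N * (∑ i, E.spin q.1 (σ i) * E.spin q.2 (τ i)) ^ 2) := by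
      simpa only [smul_eq_mul] using convexOn_exp.map_sum_le (t := Finset.univ)
        (w := fun _ : T × T => w)
        (p := fun q : T × T => 2 * l / N * (∑ i, E.spin q.1 (σ i) * E.spin q.2 (τ i)) ^ 2)
        (fun _ _ => hw0) hw1 (fun _ _ => Set.mem_univ _)
    rw [e1, Real.exp_add, Real.exp_add]
    have e3 : Real.exp (∑ q : T × T,
        w * (2 * l / N * (∑ i, E.spin q.1 (σ i) * E.spin q.2 (τ i)) ^ 2) - 2 * l) ≤
        ∑ q : T × T, w * Real.exp (2 * l / N * (∑ i, E.spin q.1 (σ i) * E.spin q.2 (τ i)) ^ 2) :=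
      (Real.exp_le_exp.2 (by linarith)).trans e2
    refine le_trans (le_of_eq ?_) (mul_le_mul_of_nonneg_left e3 (mul_nonneg (hU0 σ) (hU0 τ)))
    simp only [hU]; ring
  calc _ ≤ ∑ σ, ∑ τ, U σ * U τ * ∑ q : T × T,
        w * Real.exp (2 * l / N * (∑ i, E.spin q.1 (σ i) * E.spin q.2 (τ i)) ^ 2) :=
        Finset.sum_le_sum fun σ _ => Finset.sum_le_sum fun τ _ => key σ τ
    _ = ∑ q : T × T, w * ∑ τ, U τ * ∑ σ, U σ *
          Real.exp (2 * l / N * (∑ i, E.spin q.1 (σ i) * E.spin q.2 (τ i)) ^ 2) := by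
        simp only [Finset.mul_sum]
        rw [Finset.sum_comm]
        rw [Finset.sum_congr rfl fun τ _ => Finset.sum_comm, Finset.sum_comm]
        refine Finset.sum_congr rfl fun q _ => Finset.sum_congr rfl fun τ _ =>
          Finset.sum_congr rfl fun σ _ => ?_
        ring
    _ ≤ ∑ q : T × T, w * ∑ τ, U τ * (E.annealed N l * C) := by
        gcongr with q _ τ _
        · exact hU0 τ
        · exact E.sum_annealed_exp_sq_le hN hl hl' q.1 _ fun i => E.spin_sq _ _
    _ = C * E.annealed N l ^ 2 := by
        rw [← Finset.sum_mul, ← Finset.sum_mul, hw1]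
        simp only [hU, annealed]; ring

end SpinEnsemble

/-! ### Gaussian concentration -/

section Concentration

variable {ι : Type*} [Fintype ι]

theorem continuous_of_abs_sub_le_sum {F : (ι → ℝ) → ℝ} {c : ℝ}
    (hF : ∀ x y, |F x - F y| ≤ c * ∑ i, |x i - y i|) : Continuous F := by
  refine continuous_iff_continuousAt.2 fun y => ?_
  refine tendsto_iff_dist_tendsto_zero.2 (squeeze_zero (fun _ => dist_nonneg) (fun x => hF x y) ?_)
  have : Continuous fun x : ι → ℝ => c * ∑ i, |x i - y i| := by fun_prop
  simpa using this.tendsto y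

theorem integrable_exp_of_abs_sub_le_sum {F : (ι → ℝ) → ℝ} {c : ℝ}
    (hF : ∀ x y, |F x - F y| ≤ c * ∑ i, |x i - y i|) :
    Integrable (fun x => Real.exp (F x)) (stdGaussian ι) := by
  refine ((integrable_exp_sum_abs_stdGaussian (ι := ι) c).const_mul (Real.exp (F 0))).mono'
    (Real.continuous_exp.comp (continuous_of_abs_sub_le_sum hF)).aestronglyMeasurable
    (Eventually.of_forall fun x => ?_)
  have h := (abs_le.1 (hF x 0)).2
  simp only [Pi.zero_apply, sub_zero] at h
  rw [Real.norm_eq_abs, Real.abs_exp, ← Real.exp_add]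
  exact Real.exp_le_exp.2 (by linarith)

theorem integrable_of_integrable_exp {α : Type*} [MeasurableSpace α] {μ : Measure α} {f : α → ℝ}
    (hf : AEStronglyMeasurable f μ) (h1 : Integrable (fun x => Real.exp (f x)) μ)
    (h2 : Integrable (fun x => Real.exp (-f x)) μ) : Integrable f μ := by
  refine (h1.add h2).mono' hf (Eventually.of_forall fun x => ?_)
  rw [Real.norm_eq_abs, Pi.add_apply]
  have e1 := Real.add_one_le_exp (f x)
  have e2 := Real.add_one_le_exp (-f x)
  have e3 := Real.exp_pos (f x)
  have e4 := Real.exp_pos (-f x)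
  exact abs_le.2 ⟨by linarith, by linarith⟩

theorem integrable_of_abs_sub_le_sum {F : (ι → ℝ) → ℝ} {c : ℝ}
    (hF : ∀ x y, |F x - F y| ≤ c * ∑ i, |x i - y i|) : Integrable F (stdGaussian ι) := by
  have h1 := integrable_exp_of_abs_sub_le_sum hF
  have h2 := integrable_exp_of_abs_sub_le_sum (F := fun x => -F x) (c := c) fun x y => by
    rw [neg_sub_neg, abs_sub_comm]; exact hF x y
  exact integrable_of_integrable_exp (continuous_of_abs_sub_le_sum hF).aestronglyMeasurable h1 h2

end Concentration

theorem exp_integral_le {α : Type*} [MeasurableSpace α] {μ : Measure α} [IsProbabilityMeasure μ]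
    {f : α → ℝ} (hf : Integrable f μ) (hf' : Integrable (fun x => Real.exp (f x)) μ) :
    Real.exp (∫ x, f x ∂μ) ≤ ∫ x, Real.exp (f x) ∂μ :=
  convexOn_exp.map_integral_le Real.continuous_exp.continuousOn isClosed_univ (by simp) hf hf'

theorem exp_add_exp_neg_le_of_abs_le {u w : ℝ} (h : |u| ≤ |w|) :
    Real.exp u + Real.exp (-u) ≤ Real.exp w + Real.exp (-w) := by
  have := Real.cosh_le_cosh.2 h
  rw [Real.cosh_eq, Real.cosh_eq] at this
  linarith

/-- The exponential moment bound for a Lipschitz function of one Gaussian variable, by comparison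
with an independent copy: the difference of two copies is symmetric, so that its exponential moment
is a mean of hyperbolic cosines, which are monotone in the Lipschitz bound. -/
theorem integral_exp_le_of_lipschitz_gaussian {f : ℝ → ℝ} {c : ℝ}
    (hf : ∀ x y, |f x - f y| ≤ c * |x - y|) :
    ∫ x, Real.exp (f x) ∂(gaussianReal 0 1) ≤
      Real.exp (c ^ 2 + ∫ x, f x ∂(gaussianReal 0 1)) := by
  set γ := gaussianReal 0 1
  have hfc : Continuous f := by
    refine continuous_iff_continuousAt.2 fun y => ?_
    refine tendsto_iff_dist_tendsto_zero.2 (squeeze_zero (fun _ => dist_nonneg) (fun x => hf x y) ?_)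
    have : Continuous fun x : ℝ => c * |x - y| := by fun_prop
    simpa using this.tendsto y
  have hexp : ∀ t : ℝ, Integrable (fun x => Real.exp (t * x)) γ := integrable_exp_mul_gaussianReal
  have hi : ∀ {h : ℝ → ℝ}, Continuous h → (∀ x, |h x - h 0| ≤ c * |x|) →
      Integrable (fun x => Real.exp (h x)) γ := by
    intro h hc hh
    refine ((integrable_exp_mul_abs (hexp c) (hexp (-c))).const_mul (Real.exp (h 0))).mono'
      (Real.continuous_exp.comp hc).aestronglyMeasurable (Eventually.of_forall fun x => ?_)
    rw [Real.norm_eq_abs, Real.abs_exp, ← Real.exp_add]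
    exact Real.exp_le_exp.2 (by linarith [(abs_le.1 (hh x)).2])
  have h1 : Integrable (fun x => Real.exp (f x)) γ := hi hfc fun x => by simpa using hf x 0
  have h2 : Integrable (fun x => Real.exp (-f x)) γ := hi hfc.neg fun x => by
    rw [neg_sub_neg, abs_sub_comm]; simpa using hf x 0
  have h0 : Integrable f γ := integrable_of_integrable_exp hfc.aestronglyMeasurable h1 h2
  have key : 2 * ((∫ x, Real.exp (f x) ∂γ) * ∫ x, Real.exp (-f x) ∂γ) ≤ 2 * Real.exp (c ^ 2) := by
    calc _ = ∫ z : ℝ × ℝ, (Real.exp (f z.1) * Real.exp (-f z.2) +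
            Real.exp (-f z.1) * Real.exp (f z.2)) ∂(γ.prod γ) := by
          rw [integral_add (h1.mul_prod h2) (h2.mul_prod h1),
            integral_prod_mul (fun x => Real.exp (f x)) (fun x => Real.exp (-f x)),
            integral_prod_mul (fun x => Real.exp (-f x)) (fun x => Real.exp (f x))]
          ring
      _ ≤ ∫ z : ℝ × ℝ, (Real.exp (c * z.1) * Real.exp (-c * z.2) +
            Real.exp (-c * z.1) * Real.exp (c * z.2)) ∂(γ.prod γ) := by
          refine integral_mono ((h1.mul_prod h2).add (h2.mul_prod h1))
            (((hexp c).mul_prod (hexp (-c))).add ((hexp (-c)).mul_prod (hexp c))) fun z => ?_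
          simp only [← Real.exp_add]
          have hle : |f z.1 - f z.2| ≤ |c * (z.1 - z.2)| := by
            rw [abs_mul]
            exact (hf _ _).trans (mul_le_mul_of_nonneg_right (le_abs_self c) (abs_nonneg _))
          have := exp_add_exp_neg_le_of_abs_le hle
          have e1 : -f z.1 + f z.2 = -(f z.1 - f z.2) := by ring
          have e2 : c * z.1 + -c * z.2 = c * (z.1 - z.2) := by ring
          have e3 : -c * z.1 + c * z.2 = -(c * (z.1 - z.2)) := by ring
          rw [e1, e2, e3, ← sub_eq_add_neg]
          exact this
      _ = 2 * Real.exp (c ^ 2) := by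
          rw [integral_add ((hexp c).mul_prod (hexp (-c))) ((hexp (-c)).mul_prod (hexp c)),
            integral_prod_mul (fun x => Real.exp (c * x)) (fun x => Real.exp (-c * x)),
            integral_prod_mul (fun x => Real.exp (-c * x)) (fun x => Real.exp (c * x))]
          simp only [γ, integral_exp_mul_gaussian, ← Real.exp_add]
          ring_nf
  have hA : 0 ≤ ∫ x, Real.exp (f x) ∂γ := integral_nonneg fun _ => (Real.exp_pos _).le
  have hJ : Real.exp (-∫ x, f x ∂γ) ≤ ∫ x, Real.exp (-f x) ∂γ := by
    rw [← integral_neg]; exact exp_integral_le h0.neg h2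
  have h3 : (∫ x, Real.exp (f x) ∂γ) * Real.exp (-∫ x, f x ∂γ) ≤ Real.exp (c ^ 2) :=
    (mul_le_mul_of_nonneg_left hJ hA).trans (by linarith)
  rwa [Real.exp_neg, ← div_eq_mul_inv, div_le_iff₀ (Real.exp_pos _), ← Real.exp_add] at h3

theorem integral_exp_le_of_abs_sub_le_sum_fin {n : ℕ} {F : (Fin n → ℝ) → ℝ} {c : ℝ}
    (hF : ∀ x y, |F x - F y| ≤ c * ∑ i, |x i - y i|) :
    ∫ x, Real.exp (F x) ∂(stdGaussian (Fin n)) ≤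
      Real.exp (n * c ^ 2 + ∫ x, F x ∂(stdGaussian (Fin n))) := by
  induction n with
  | zero => simp [stdGaussian, integral_unique, measureReal_def]
  | succ n ih =>
    have hmp := (measurePreserving_piFinSuccAbove
      (fun _ : Fin (n + 1) => gaussianReal 0 1) 0).symm
    have hint : ∀ G : (Fin (n + 1) → ℝ) → ℝ, Integrable G (stdGaussian (Fin (n + 1))) →
        Integrable (fun z : ℝ × (Fin n → ℝ) => G (Fin.cons z.1 z.2))
            ((gaussianReal 0 1).prod (stdGaussian (Fin n))) ∧
          ∫ x, G x ∂(stdGaussian (Fin (n + 1))) =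
          ∫ y, ∫ z, G (Fin.cons z y) ∂(gaussianReal 0 1) ∂(stdGaussian (Fin n)) := by
      intro G hG
      have e1 : Integrable (fun z : ℝ × (Fin n → ℝ) => G (Fin.cons z.1 z.2))
          ((gaussianReal 0 1).prod (stdGaussian (Fin n))) := by
        rw [← hmp.integrable_comp_emb (MeasurableEquiv.measurableEmbedding _)] at hG
        simpa [Function.comp_def, Fin.insertNthEquiv] using hG
      refine ⟨e1, ?_⟩
      rw [← integral_prod_symm (fun z : ℝ × (Fin n → ℝ) => G (Fin.cons z.1 z.2)) e1,
        ← hmp.integral_comp']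
      simp [Fin.insertNthEquiv]
    have hFz : ∀ y x z, |F (Fin.cons x y) - F (Fin.cons z y)| ≤ c * |x - z| := by
      intro y x z
      simpa [Fin.sum_univ_succ] using hF (Fin.cons x y) (Fin.cons z y)
    have hFi := hint F (integrable_of_abs_sub_le_sum hF)
    have hEi := hint (fun x => Real.exp (F x)) (integrable_exp_of_abs_sub_le_sum hF)
    set Fb : (Fin n → ℝ) → ℝ := fun y => ∫ z, F (Fin.cons z y) ∂(gaussianReal 0 1) with hFb
    have hsec : ∀ y, Integrable (fun z => F (Fin.cons z y)) (gaussianReal 0 1) := by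
      intro y
      have hc : Continuous fun z : ℝ => F (Fin.cons z y) :=
        (continuous_of_abs_sub_le_sum hF).comp (by fun_prop)
      have hid : Integrable (fun z : ℝ => |z|) (gaussianReal 0 1) :=
        ((memLp_id_gaussianReal 1).integrable (by simp)).abs
      refine ((hid.const_mul c).add (integrable_const |F (Fin.cons 0 y)|)).mono'
        hc.aestronglyMeasurable (Eventually.of_forall fun z => ?_)
      have h1 := hFz y z 0
      rw [sub_zero] at h1
      have h2 := abs_sub_abs_le_abs_sub (F (Fin.cons z y)) (F (Fin.cons 0 y))
      simp only [Real.norm_eq_abs, Pi.add_apply]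
      linarith
    have hFbL : ∀ x y, |Fb x - Fb y| ≤ c * ∑ i, |x i - y i| := by
      intro x y
      rw [hFb]
      simp only
      rw [← integral_sub (hsec x) (hsec y)]
      have := norm_integral_le_of_norm_le_const (μ := gaussianReal 0 1)
        (f := fun z => F (Fin.cons z x) - F (Fin.cons z y)) (C := c * ∑ i, |x i - y i|)
        (Eventually.of_forall fun z => by
          simpa [Fin.sum_univ_succ] using hF (Fin.cons z x) (Fin.cons z y))
      simpa using this
    rw [hFi.2, hEi.2]
    calc ∫ y, ∫ z, Real.exp (F (Fin.cons z y)) ∂(gaussianReal 0 1) ∂(stdGaussian (Fin n))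
        ≤ ∫ y, Real.exp (c ^ 2) * Real.exp (Fb y) ∂(stdGaussian (Fin n)) := by
          refine integral_mono hEi.1.integral_prod_right
            ((integrable_exp_of_abs_sub_le_sum hFbL).const_mul _) fun y => ?_
          rw [← Real.exp_add]
          exact integral_exp_le_of_lipschitz_gaussian (hFz y)
      _ ≤ Real.exp (c ^ 2) * Real.exp (n * c ^ 2 + ∫ y, Fb y ∂(stdGaussian (Fin n))) := by
          rw [integral_const_mul]
          exact mul_le_mul_of_nonneg_left (ih hFbL) (Real.exp_pos _).le
      _ = _ := by rw [← Real.exp_add]; congr 1; push_cast; ring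

/-- The exponential moment bound tensorises: it is applied to one coordinate at a time, and the
partial mean over a coordinate is Lipschitz in the others. -/
theorem integral_exp_le_of_abs_sub_le_sum {ι : Type*} [Fintype ι] {F : (ι → ℝ) → ℝ} {c : ℝ}
    (hF : ∀ x y, |F x - F y| ≤ c * ∑ i, |x i - y i|) :
    ∫ x, Real.exp (F x) ∂(stdGaussian ι) ≤
      Real.exp (Fintype.card ι * c ^ 2 + ∫ x, F x ∂(stdGaussian ι)) := by
  let e := (Fintype.equivFin ι).symm
  have hmp := measurePreserving_piCongrLeft (fun _ : ι => gaussianReal 0 1) e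
  rw [← hmp.integral_comp' F, ← hmp.integral_comp' fun x => Real.exp (F x)]
  refine integral_exp_le_of_abs_sub_le_sum_fin
    (F := fun x => F (MeasurableEquiv.piCongrLeft (fun _ : ι => ℝ) e x)) fun x y => ?_
  refine (hF _ _).trans_eq ?_
  rw [← e.sum_comp]
  simp only [MeasurableEquiv.coe_piCongrLeft, Equiv.piCongrLeft_apply_apply]

theorem measureReal_sub_integral_le {ι : Type*} [Fintype ι] {F : (ι → ℝ) → ℝ} {c : ℝ}
    (hF : ∀ x y, |F x - F y| ≤ c * ∑ i, |x i - y i|) (r : ℝ) {s : ℝ} (hs : 0 ≤ s) :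
    (stdGaussian ι).real {x | r ≤ F x - ∫ y, F y ∂(stdGaussian ι)} ≤
      Real.exp (Fintype.card ι * (s * c) ^ 2 - s * r) := by
  set m := ∫ y, F y ∂(stdGaussian ι)
  have hsF : ∀ x y, |s * (F x - m) - s * (F y - m)| ≤ (s * c) * ∑ i, |x i - y i| := by
    intro x y
    rw [← mul_sub, sub_sub_sub_cancel_right, abs_mul, abs_of_nonneg hs, mul_assoc]
    exact mul_le_mul_of_nonneg_left (hF x y) hs
  have h1 := measure_ge_le_exp_mul_mgf (μ := stdGaussian ι) (X := fun x => F x - m) r hs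
    (integrable_exp_of_abs_sub_le_sum hsF)
  have h2 := integral_exp_le_of_abs_sub_le_sum hsF
  have h3 : ∫ x, s * (F x - m) ∂(stdGaussian ι) = 0 := by
    rw [integral_const_mul, integral_sub (integrable_of_abs_sub_le_sum hF) (integrable_const _)]
    simp [m]
  rw [h3, add_zero] at h2
  calc _ ≤ _ := h1
    _ ≤ Real.exp (-s * r) * Real.exp (Fintype.card ι * (s * c) ^ 2) :=
      mul_le_mul_of_nonneg_left h2 (Real.exp_pos _).le
    _ = _ := by rw [← Real.exp_add]; congr 1; ring

/-- Gaussian concentration of a function that is Lipschitz in the `ℓ¹` distance. -/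
theorem measureReal_abs_sub_integral_le {ι : Type*} [Fintype ι] {F : (ι → ℝ) → ℝ} {c : ℝ}
    (hF : ∀ x y, |F x - F y| ≤ c * ∑ i, |x i - y i|) (r : ℝ) {s : ℝ} (hs : 0 ≤ s) :
    (stdGaussian ι).real {x | r ≤ |F x - ∫ y, F y ∂(stdGaussian ι)|} ≤
      2 * Real.exp (Fintype.card ι * (s * c) ^ 2 - s * r) := by
  have hF' : ∀ x y, |-F x - -F y| ≤ c * ∑ i, |x i - y i| := fun x y => by
    rw [neg_sub_neg, abs_sub_comm]; exact hF x y
  have h1 := measureReal_sub_integral_le hF r hs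
  have h2 := measureReal_sub_integral_le hF' r hs
  rw [integral_neg] at h2
  have hsub : {x | r ≤ |F x - ∫ y, F y ∂(stdGaussian ι)|} ⊆
      {x | r ≤ F x - ∫ y, F y ∂(stdGaussian ι)} ∪
        {x | r ≤ -F x - -∫ y, F y ∂(stdGaussian ι)} := by
    intro x hx
    rcases le_abs.1 (Set.mem_ofPred_eq ▸ hx) with h | h
    · exact Or.inl h
    · right
      simp only [Set.mem_ofPred_eq]
      linarith
  calc _ ≤ _ := measureReal_mono hsub
    _ ≤ _ := measureReal_union_le _ _
    _ ≤ _ := by linarith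

/-- A second moment bound, together with an upper tail bound, controls the mean. -/
theorem integral_le_two_mul_of_sq_le {α : Type*} [MeasurableSpace α] {μ : Measure α}
    [IsProbabilityMeasure μ] {Z : α → ℝ} (hZ : Integrable Z μ)
    (hZ2 : Integrable (fun x => Z x ^ 2) μ) (hm : 0 < ∫ x, Z x ∂μ) {C a : ℝ} (hC : 0 < C)
    (h : ∫ x, Z x ^ 2 ∂μ ≤ C * (∫ x, Z x ∂μ) ^ 2) (ha : 0 ≤ a) (hmeas : MeasurableSet {x | a ≤ Z x})
    (htail : μ.real {x | a ≤ Z x} ≤ (4 * C)⁻¹) : ∫ x, Z x ∂μ ≤ 2 * a := by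
  set m := ∫ x, Z x ∂μ
  have hCm : 0 < C * m := mul_pos hC hm
  -- Where `a ≤ Z`, the inequality `Z ≤ Z² / (4K) + K` is used with `K = C m`, which makes each of
  -- the two terms contribute at most `m / 4`.
  have hpt : ∀ x, Z x ≤ a + (4 * (C * m))⁻¹ * Z x ^ 2 +
      (C * m) * Set.indicator {x | a ≤ Z x} 1 x := by
    intro x
    by_cases hx : a ≤ Z x
    · have : Set.indicator {x | a ≤ Z x} (1 : α → ℝ) x = 1 :=
        Set.indicator_of_mem (s := {x | a ≤ Z x}) hx _
      rw [this, mul_one]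
      have h3 : Z x ≤ (4 * (C * m))⁻¹ * Z x ^ 2 + C * m := by
        have : (4 * (C * m))⁻¹ * Z x ^ 2 + C * m - Z x =
            (4 * (C * m))⁻¹ * (Z x - 2 * (C * m)) ^ 2 := by field_simp; ring
        have h4 : 0 ≤ (4 * (C * m))⁻¹ * (Z x - 2 * (C * m)) ^ 2 := by positivity
        linarith
      linarith
    · have : Set.indicator {x | a ≤ Z x} (1 : α → ℝ) x = 0 :=
        Set.indicator_of_notMem (s := {x | a ≤ Z x}) hx _
      rw [this, mul_zero, add_zero]
      have h4 : 0 ≤ (4 * (C * m))⁻¹ * Z x ^ 2 := by positivity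
      linarith [not_le.1 hx]
  have hind : Integrable (Set.indicator {x | a ≤ Z x} (1 : α → ℝ)) μ :=
    (integrable_const (1 : ℝ)).indicator hmeas
  have h5 := integral_mono hZ (((integrable_const a).add (hZ2.const_mul _)).add
    (hind.const_mul (C * m))) hpt
  have h6 : ∫ x, (a + (4 * (C * m))⁻¹ * Z x ^ 2 +
      (C * m) * Set.indicator {x | a ≤ Z x} 1 x) ∂μ =
      a + (4 * (C * m))⁻¹ * ∫ x, Z x ^ 2 ∂μ + (C * m) * μ.real {x | a ≤ Z x} := by
    rw [integral_add (f := fun x => a + (4 * (C * m))⁻¹ * Z x ^ 2)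
        ((integrable_const a).add (hZ2.const_mul _)) (hind.const_mul (C * m)),
      integral_add (integrable_const a) (hZ2.const_mul _), integral_const_mul, integral_const_mul,
      integral_indicator_one hmeas]
    simp
  have h7 : (4 * (C * m))⁻¹ * ∫ x, Z x ^ 2 ∂μ ≤ m / 4 := by
    calc _ ≤ (4 * (C * m))⁻¹ * (C * m ^ 2) := mul_le_mul_of_nonneg_left h (by positivity)
      _ = m / 4 := by field_simp
  have h8 : (C * m) * μ.real {x | a ≤ Z x} ≤ m / 4 := by
    calc _ ≤ (C * m) * (4 * C)⁻¹ := mul_le_mul_of_nonneg_left htail hCm.le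
      _ = m / 4 := by field_simp
  have h9 : m ≤ a + (4 * (C * m))⁻¹ * ∫ x, Z x ^ 2 ∂μ + (C * m) * μ.real {x | a ≤ Z x} :=
    h5.trans_eq h6
  linarith

/-- Borel–Cantelli: summable deviation probabilities give almost sure convergence to zero. -/
theorem ae_tendsto_zero_of_summable {Ω : Type*} [MeasurableSpace Ω] {P : Measure Ω}
    [IsProbabilityMeasure P] {X : ℕ → Ω → ℝ}
    (h : ∀ ε : ℝ, 0 < ε → Summable fun N => P.real {ω | ε ≤ |X N ω|}) :
    ∀ᵐ ω ∂P, Tendsto (fun N => X N ω) atTop (𝓝 0) := by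
  have h1 : ∀ k : ℕ, ∀ᵐ ω ∂P, ∀ᶠ N in atTop, ω ∉ {ω | 1 / ((k : ℝ) + 1) ≤ |X N ω|} := by
    intro k
    refine ae_eventually_notMem ?_
    have hs := (h (1 / ((k : ℝ) + 1)) (by positivity)).tsum_ofReal_ne_top
    simpa only [ofReal_measureReal (measure_ne_top _ _)] using hs
  filter_upwards [ae_all_iff.2 h1] with ω hω
  refine Metric.tendsto_nhds.2 fun ε hε => ?_
  obtain ⟨k, hk⟩ := exists_nat_one_div_lt hε
  filter_upwards [hω k] with N hN
  rw [Real.dist_eq, sub_zero]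
  exact (not_le.1 hN).trans hk

/-! ### The partition function as a function of finitely many couplings -/

/-- The closed single-site paths with `n + 1` time steps, as a spin ensemble with total mass
`2 cosh h`. -/
noncomputable def pathEnsemble {h : ℝ} (hh : 0 ≤ h) (n : ℕ) :
    SpinEnsemble (Fin (n + 1)) (Fin (n + 2) → Fin 2) where
  weight := pathWeight h (n + 1)
  spin k q := spinSign (q k.castSucc)
  flip := Equiv.piCongrRight fun _ => Fin.revPerm
  weight_nonneg q := by
    unfold pathWeight
    split_ifs
    · exact Finset.prod_nonneg fun k _ => hopping_nonneg (by positivity) _ _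
    · exact le_rfl
  weight_flip q := by
    simp [pathWeight, hopping_rev, Pi.map_apply]
  spin_sq k q := by
    rcases spinSign_eq_or (q k.castSucc) with h | h <;> simp [h]
  spin_flip k q := by
    simp only [Equiv.piCongrRight_apply, Pi.map_apply, Fin.revPerm_apply]
    generalize q k.castSucc = e
    fin_cases e <;> simp [spinSign, Fin.rev]

theorem sum_weight_pathEnsemble {h : ℝ} (hh : 0 ≤ h) (n : ℕ) :
    ∑ q, (pathEnsemble hh n).weight q = 2 * Real.cosh h :=
  sum_pathWeight h n.succ_ne_zero

theorem tendsto_pathEnsemble_partition {β b : ℝ} (hh : 0 ≤ β * b) (v : ℝ) (N : ℕ)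
    (g : ℕ → ℕ → ℝ) :
    Tendsto (fun n => (pathEnsemble hh n).partition N (β * v / √N) fun p => g p.1.1 p.1.2) atTop
      (𝓝 (partitionFunction β v b N g)) := by
  refine ((tendsto_trace_trotterStep_pow β v b N g).comp (tendsto_add_atTop_nat 1)).congr fun n => ?_
  rw [Function.comp_apply, trace_trotterStep_pow, SpinEnsemble.partition]
  refine Finset.sum_congr rfl fun σ _ => ?_
  rw [SpinEnsemble.configWeight]
  congr 2
  simp only [isingSum, ← sum_pair (N := N) fun i j => g i j * (spinSign _ * spinSign _),
    SpinEnsemble.overlap, pathEnsemble, Fintype.card_fin, Finset.mul_sum]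
  rw [Finset.sum_comm]
  refine Finset.sum_congr rfl fun p _ => Finset.sum_congr rfl fun k _ => ?_
  ring

/-- The couplings between `N` sites, extended by zero. -/
def extendCouplings {N : ℕ} (x : Pair N → ℝ) (i j : ℕ) : ℝ :=
  if h : i < N ∧ j < N ∧ i < j then x ⟨(⟨i, h.1⟩, ⟨j, h.2.1⟩), h.2.2⟩ else 0

theorem extendCouplings_apply {N : ℕ} (x : Pair N → ℝ) (p : Pair N) :
    extendCouplings x p.1.1 p.1.2 = x p :=
  dif_pos ⟨p.1.1.2, p.1.2.2, p.2⟩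

/-- The partition function as a function of the finitely many couplings it depends on. -/
noncomputable def pairPartition (β v b : ℝ) (N : ℕ) (x : Pair N → ℝ) : ℝ :=
  partitionFunction β v b N (extendCouplings x)

section PairPartition

variable {β v b : ℝ} (hβ : 0 ≤ β) (hv : 0 ≤ v) (hb : 0 ≤ b) (N : ℕ)
include hβ hb

theorem tendsto_partition_pairPartition (v : ℝ) (x : Pair N → ℝ) :
    Tendsto (fun n => (pathEnsemble (mul_nonneg hβ hb) n).partition N (β * v / √N) x) atTop
      (𝓝 (pairPartition β v b N x)) := by
  have h := tendsto_pathEnsemble_partition (mul_nonneg hβ hb) v N (extendCouplings x)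
  simp only [extendCouplings_apply] at h
  exact h

theorem partitionFunction_eq_pairPartition (v : ℝ) (g : ℕ → ℕ → ℝ) :
    partitionFunction β v b N g = pairPartition β v b N fun p => g p.1.1 p.1.2 :=
  tendsto_nhds_unique (tendsto_pathEnsemble_partition (mul_nonneg hβ hb) v N g)
    (tendsto_partition_pairPartition hβ hb N v _)

theorem pairPartition_zero (v : ℝ) :
    pairPartition β v b N 0 = (2 * Real.cosh (β * b)) ^ N := by
  refine tendsto_nhds_unique (tendsto_partition_pairPartition hβ hb N v 0) ?_
  simp only [SpinEnsemble.partition_zero, sum_weight_pathEnsemble]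
  exact tendsto_const_nhds

include hv

theorem pairPartition_le (x y : Pair N → ℝ) : pairPartition β v b N x ≤
    Real.exp (β * v / √N * ∑ p, |x p - y p|) * pairPartition β v b N y :=
  le_of_tendsto_of_tendsto' (tendsto_partition_pairPartition hβ hb N v x)
    ((tendsto_partition_pairPartition hβ hb N v y).const_mul _)
    fun _ => SpinEnsemble.partition_le _ (by positivity) x y

theorem pairPartition_pos (x : Pair N → ℝ) : 0 < pairPartition β v b N x := by
  have h := pairPartition_le hβ hv hb N 0 x
  rw [pairPartition_zero hβ hb] at h
  have h0 : 0 < (2 * Real.cosh (β * b)) ^ N := by have := Real.cosh_pos (β * b); positivity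
  exact pos_of_mul_pos_right (h0.trans_le h) (Real.exp_pos _).le

theorem abs_log_pairPartition_sub_le (x y : Pair N → ℝ) :
    |Real.log (pairPartition β v b N x) - Real.log (pairPartition β v b N y)| ≤
      β * v / √N * ∑ p, |x p - y p| := by
  have key : ∀ x y, Real.log (pairPartition β v b N x) - Real.log (pairPartition β v b N y) ≤
      β * v / √N * ∑ p, |x p - y p| := by
    intro x y
    have h := Real.log_le_log (pairPartition_pos hβ hv hb N x) (pairPartition_le hβ hv hb N x y)
    rw [Real.log_mul (Real.exp_pos _).ne' (pairPartition_pos hβ hv hb N y).ne', Real.log_exp] at h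
    linarith
  refine abs_sub_le_iff.2 ⟨key x y, ?_⟩
  simpa only [abs_sub_comm] using key y x

theorem continuous_pairPartition : Continuous (pairPartition β v b N) := by
  have h := continuous_of_abs_sub_le_sum (abs_log_pairPartition_sub_le hβ hv hb N)
  refine (Real.continuous_exp.comp h).congr fun x => ?_
  exact Real.exp_log (pairPartition_pos hβ hv hb N x)

theorem norm_partition_le (n : ℕ) (x : Pair N → ℝ) :
    ‖(pathEnsemble (mul_nonneg hβ hb) n).partition N (β * v / √N) x‖ ≤
      Real.exp (β * v / √N * ∑ p, |x p|) * (2 * Real.cosh (β * b)) ^ N := by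
  rw [Real.norm_of_nonneg (SpinEnsemble.partition_nonneg _ _ _ _)]
  have h := (pathEnsemble (mul_nonneg hβ hb) n).partition_le (c := β * v / √N) (by positivity) x 0
  simpa [SpinEnsemble.partition_zero, sum_weight_pathEnsemble] using h

theorem integrable_pairPartition_pow (k : ℕ) :
    Integrable (fun x => pairPartition β v b N x ^ k) (stdGaussian (Pair N)) := by
  have h := integrable_exp_of_abs_sub_le_sum (F := fun x => k * Real.log (pairPartition β v b N x))
    (c := k * (β * v / √N)) fun x y => by
      rw [← mul_sub, abs_mul, Nat.abs_cast, mul_assoc]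
      exact mul_le_mul_of_nonneg_left (abs_log_pairPartition_sub_le hβ hv hb N x y) (by positivity)
  refine h.congr (Eventually.of_forall fun x => ?_)
  simp only
  rw [Real.exp_nat_mul, Real.exp_log (pairPartition_pos hβ hv hb N x)]

theorem tendsto_integral_partition_pow (k : ℕ) :
    Tendsto (fun n => ∫ x, (pathEnsemble (mul_nonneg hβ hb) n).partition N (β * v / √N) x ^ k
        ∂(stdGaussian (Pair N))) atTop
      (𝓝 (∫ x, pairPartition β v b N x ^ k ∂(stdGaussian (Pair N)))) := by
  refine tendsto_integral_of_dominated_convergence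
    (fun x => (Real.exp (β * v / √N * ∑ p, |x p|) * (2 * Real.cosh (β * b)) ^ N) ^ k)
    (fun n => ((SpinEnsemble.continuous_partition _ _ _).pow k).aestronglyMeasurable) ?_
    (fun n => Eventually.of_forall fun x => ?_) (Eventually.of_forall fun x =>
      (tendsto_partition_pairPartition hβ hb N v x).pow k)
  · simp only [mul_pow, ← Real.exp_nat_mul, ← mul_assoc]
    exact ((integrable_exp_sum_abs_stdGaussian (ι := Pair N)
      (k * (β * v / √N))).mul_const _).mul_const _
  · rw [norm_pow]
    exact pow_le_pow_left₀ (norm_nonneg _) (norm_partition_le hβ hv hb N n x) k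

end PairPartition

/-! ### The annealed free energy -/

/-- The mean `E[Z_N]` of the partition function. -/
noncomputable def meanPartition (β v b : ℝ) (N : ℕ) : ℝ :=
  ∫ x, pairPartition β v b N x ∂(stdGaussian (Pair N))

/-- The Gaussian variance factor `c² / 2` in terms of `λ`; for `N = 0` both sides are zero. -/
theorem half_sq_eq (β v : ℝ) (N : ℕ) :
    2⁻¹ * (β * v / √N) ^ 2 = 2 * disorderParameter β v / N := by
  rw [div_pow, Real.sq_sqrt (Nat.cast_nonneg N), disorderParameter]
  ring

section Annealed

variable {β v b : ℝ} (hβ : 0 ≤ β) (hv : 0 ≤ v) (hb : 0 ≤ b) {N : ℕ}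
include hβ hv hb

theorem tendsto_annealed_meanPartition (N : ℕ) :
    Tendsto (fun n => (pathEnsemble (mul_nonneg hβ hb) n).annealed N (disorderParameter β v)) atTop
      (𝓝 (meanPartition β v b N)) := by
  have h := tendsto_integral_partition_pow hβ hv hb N 1
  simp only [pow_one, SpinEnsemble.integral_partition, half_sq_eq] at h
  exact h

theorem one_le_meanPartition (N : ℕ) : 1 ≤ meanPartition β v b N := by
  refine ge_of_tendsto' (tendsto_annealed_meanPartition hβ hv hb N) fun n => ?_
  refine le_trans ?_ (SpinEnsemble.pow_le_annealed _ N (by unfold disorderParameter; positivity))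
  rw [sum_weight_pathEnsemble]
  exact one_le_pow₀ (by linarith [Real.one_le_cosh (β * b)])

theorem exp_mul_meanPartition_add_le {M N : ℕ} (hM : M ≠ 0) (hN : N ≠ 0) :
    Real.exp (disorderParameter β v) * meanPartition β v b (M + N) ≤
      (Real.exp (disorderParameter β v) * meanPartition β v b M) *
        (Real.exp (disorderParameter β v) * meanPartition β v b N) :=
  le_of_tendsto_of_tendsto' ((tendsto_annealed_meanPartition hβ hv hb _).const_mul _)
    (((tendsto_annealed_meanPartition hβ hv hb _).const_mul _).mul
      ((tendsto_annealed_meanPartition hβ hv hb _).const_mul _))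
    fun _ => SpinEnsemble.exp_mul_annealed_add_le _ hM hN (by unfold disorderParameter; positivity)

/-- By Fekete's lemma, `ln E[Z_N] / N` converges. -/
theorem exists_tendsto_log_meanPartition_div :
    ∃ L : ℝ, Tendsto (fun N : ℕ => Real.log (meanPartition β v b N) / N) atTop (𝓝 L) := by
  set l := disorderParameter β v with hl
  have hl0 : 0 ≤ l := by rw [hl, disorderParameter]; positivity
  have hpos : ∀ N, 0 < meanPartition β v b N := fun N =>
    zero_lt_one.trans_le (one_le_meanPartition hβ hv hb N)
  have hlog : ∀ N, 0 ≤ Real.log (meanPartition β v b N) := fun N =>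
    Real.log_nonneg (one_le_meanPartition hβ hv hb N)
  -- The value of `u` at zero is `l ≥ 0`, so that subadditivity also holds when an index is zero.
  let u : ℕ → ℝ := fun N => l + Real.log (meanPartition β v b N)
  have hu : ∀ N, u N = Real.log (Real.exp l * meanPartition β v b N) := fun N => by
    rw [Real.log_mul (Real.exp_pos _).ne' (hpos N).ne', Real.log_exp]
  have hu0 : ∀ N, 0 ≤ u N := fun N => add_nonneg hl0 (hlog N)
  have hsub : Subadditive u := by
    intro M N
    rcases eq_or_ne M 0 with rfl | hM
    · rw [zero_add]; linarith [hu0 0]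
    rcases eq_or_ne N 0 with rfl | hN
    · rw [add_zero]; linarith [hu0 0]
    have hM' : 0 < Real.exp l * meanPartition β v b M := mul_pos (Real.exp_pos _) (hpos M)
    have hN' : 0 < Real.exp l * meanPartition β v b N := mul_pos (Real.exp_pos _) (hpos N)
    rw [hu, hu, hu, ← Real.log_mul hM'.ne' hN'.ne']
    exact Real.log_le_log (mul_pos (Real.exp_pos _) (hpos _))
      (exp_mul_meanPartition_add_le hβ hv hb hM hN)
  have hbdd : BddBelow (Set.range fun n : ℕ => u n / n) :=
    ⟨0, by rintro _ ⟨n, rfl⟩; exact div_nonneg (hu0 n) n.cast_nonneg⟩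
  refine ⟨hsub.lim, ?_⟩
  have h := (hsub.tendsto_lim hbdd).sub (tendsto_const_div_atTop_nhds_zero_nat l)
  rw [sub_zero] at h
  refine h.congr fun n => ?_
  rw [← sub_div, add_sub_cancel_left]

theorem integral_pairPartition_sq_le (hN : N ≠ 0) (hweak : 4 * disorderParameter β v < 1) :
    ∫ x, pairPartition β v b N x ^ 2 ∂(stdGaussian (Pair N)) ≤
      (∫ z, Real.exp (2 * disorderParameter β v * z ^ 2) ∂(gaussianReal 0 1)) *
        meanPartition β v b N ^ 2 := by
  refine le_of_tendsto_of_tendsto' (tendsto_integral_partition_pow hβ hv hb N 2)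
    (((tendsto_annealed_meanPartition hβ hv hb N).pow 2).const_mul _) fun n => ?_
  rw [SpinEnsemble.integral_partition_sq, half_sq_eq]
  exact SpinEnsemble.sum_sum_exp_le _ hN (by unfold disorderParameter; positivity) hweak

end Annealed

/-! ### The quenched free energy -/

/-- The mean `E[ln Z_N]`. -/
noncomputable def meanLogPartition (β v b : ℝ) (N : ℕ) : ℝ :=
  ∫ x, Real.log (pairPartition β v b N x) ∂(stdGaussian (Pair N))

theorem summable_exp_neg_mul_nat {a : ℝ} (ha : 0 < a) :
    Summable fun N : ℕ => Real.exp (-a * N) := by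
  simpa only [mul_comm] using Real.summable_exp_nat_mul_iff.2 (neg_lt_zero.2 ha)

section Quenched

variable {β v b : ℝ} (hβ : 0 < β) (hv : 0 < v) (hb : 0 ≤ b)
include hβ hv hb

/-- Deviations of `ln Z_N` of order `N` are exponentially unlikely. -/
theorem measureReal_abs_log_sub_le {ε : ℝ} (hε : 0 < ε) {N : ℕ} (hN : N ≠ 0) :
    (stdGaussian (Pair N)).real
        {x | ε * N ≤ |Real.log (pairPartition β v b N x) - meanLogPartition β v b N|} ≤
      2 * Real.exp (-(ε ^ 2 / (4 * (β * v) ^ 2)) * N) := by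
  have hV : 0 < β * v := mul_pos hβ hv
  have hN' : (0 : ℝ) < N := by positivity
  -- With `N ^ 2` bounding the number of couplings, the exponent is `N (s² (βv)² - s ε)`, and
  -- `s = ε / (2 (βv)²)` minimises it.
  refine (measureReal_abs_sub_integral_le (abs_log_pairPartition_sub_le hβ.le hv.le hb N) (ε * N)
    (s := ε / (2 * (β * v) ^ 2)) (by positivity)).trans ?_
  have hcard : (Fintype.card (Pair N) : ℝ) ≤ N ^ 2 := by
    have := Fintype.card_subtype_le fun p : Fin N × Fin N => p.1 < p.2
    rw [Fintype.card_prod, Fintype.card_fin, ← sq] at this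
    exact_mod_cast this
  have hsq : (ε / (2 * (β * v) ^ 2) * (β * v / √N)) ^ 2 = ε ^ 2 / (4 * (β * v) ^ 2) / N := by
    rw [mul_pow, div_pow (β * v), Real.sq_sqrt hN'.le]; field_simp; ring
  rw [hsq]
  gcongr
  calc (Fintype.card (Pair N) : ℝ) * (ε ^ 2 / (4 * (β * v) ^ 2) / N) -
        ε / (2 * (β * v) ^ 2) * (ε * N)
      ≤ (N : ℝ) ^ 2 * (ε ^ 2 / (4 * (β * v) ^ 2) / N) - ε / (2 * (β * v) ^ 2) * (ε * N) := by gcongr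
    _ = _ := by field_simp; ring

/-- The means `E[ln Z_N]` and `ln E[Z_N]` agree to leading order. -/
theorem tendsto_meanLogPartition_sub_div (hweak : 4 * disorderParameter β v < 1) :
    Tendsto (fun N : ℕ => (meanLogPartition β v b N - Real.log (meanPartition β v b N)) / N) atTop
      (𝓝 0) := by
  set C := ∫ z, Real.exp (2 * disorderParameter β v * z ^ 2) ∂(gaussianReal 0 1)
  have hC : 0 < C :=
    integral_exp_pos (integrable_exp_mul_sq_gaussian (by linarith))
  have hint : ∀ N, Integrable (pairPartition β v b N) (stdGaussian (Pair N)) := fun N => by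
    simpa using integrable_pairPartition_pow hβ.le hv.le hb N 1
  have hpos := pairPartition_pos hβ.le hv.le hb
  have hmpos : ∀ N, 0 < meanPartition β v b N := fun N =>
    zero_lt_one.trans_le (one_le_meanPartition hβ.le hv.le hb N)
  have hupper : ∀ N, meanLogPartition β v b N ≤ Real.log (meanPartition β v b N) := by
    intro N
    have h := exp_integral_le
      (integrable_of_abs_sub_le_sum (abs_log_pairPartition_sub_le hβ.le hv.le hb N))
      (integrable_exp_of_abs_sub_le_sum (abs_log_pairPartition_sub_le hβ.le hv.le hb N))
    simp only [Real.exp_log (hpos N _)] at h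
    exact (Real.le_log_iff_exp_le (hmpos N)).2 h
  refine Metric.tendsto_nhds.2 fun ε hε => ?_
  have htail : ∀ᶠ N : ℕ in atTop,
      2 * Real.exp (-((ε / 2) ^ 2 / (4 * (β * v) ^ 2)) * N) < (4 * C)⁻¹ := by
    have hV : 0 < β * v := mul_pos hβ hv
    have := ((summable_exp_neg_mul_nat (a := (ε / 2) ^ 2 / (4 * (β * v) ^ 2))
      (by positivity)).tendsto_atTop_zero).const_mul 2
    rw [mul_zero] at this
    exact this.eventually (gt_mem_nhds (by positivity))
  have hlog2 : ∀ᶠ N : ℕ in atTop, Real.log 2 / N < ε / 2 :=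
    (tendsto_const_div_atTop_nhds_zero_nat (Real.log 2)).eventually (gt_mem_nhds (by positivity))
  filter_upwards [htail, hlog2, eventually_ne_atTop 0] with N h1 h2 hN
  have hN' : (0 : ℝ) < N := by positivity
  set a := Real.exp (meanLogPartition β v b N + ε / 2 * N) with ha
  have hsub : {x | a ≤ pairPartition β v b N x} ⊆ {x | ε / 2 * N ≤
      |Real.log (pairPartition β v b N x) - meanLogPartition β v b N|} := by
    intro x hx
    have h3 : meanLogPartition β v b N + ε / 2 * N ≤ Real.log (pairPartition β v b N x) :=
      (Real.le_log_iff_exp_le (hpos N x)).2 hx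
    exact (show ε / 2 * N ≤ _ by linarith).trans (le_abs_self _)
  have h4 := integral_le_two_mul_of_sq_le (hint N) (integrable_pairPartition_pow hβ.le hv.le hb N 2)
    (hmpos N) hC (integral_pairPartition_sq_le hβ.le hv.le hb hN hweak) (Real.exp_pos _).le
    (measurableSet_le measurable_const (continuous_pairPartition hβ.le hv.le hb N).measurable)
    (((measureReal_mono hsub).trans
      (measureReal_abs_log_sub_le hβ hv hb (half_pos hε) hN)).trans h1.le)
  have h5 := Real.log_le_log (hmpos N) h4
  rw [Real.log_mul two_ne_zero (Real.exp_pos _).ne', Real.log_exp] at h5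
  rw [Real.dist_eq, sub_zero, abs_div, abs_of_nonpos (sub_nonpos.2 (hupper N)), Nat.abs_cast,
    div_lt_iff₀ hN']
  rw [div_lt_iff₀ hN'] at h2
  linarith

end Quenched

/-! ### Transfer to the probability space of the couplings -/

section Transfer

variable {Ω : Type*} [MeasurableSpace Ω] {P : Measure Ω} {g : ℕ → ℕ → Ω → ℝ}

theorem IsGaussianDisorder.aemeasurable_couplings (hg : IsGaussianDisorder P g) (N : ℕ) :
    AEMeasurable (fun ω (p : Pair N) => g p.1.1 p.1.2 ω) P :=
  aemeasurable_pi_lambda _ fun p => (hg.hasLaw _ _ p.2).aemeasurable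

/-- The couplings between `N` sites form a standard Gaussian vector. -/
theorem IsGaussianDisorder.map_couplings [IsProbabilityMeasure P] (hg : IsGaussianDisorder P g)
    (N : ℕ) : P.map (fun ω (p : Pair N) => g p.1.1 p.1.2 ω) = stdGaussian (Pair N) := by
  let e : Pair N → {p : ℕ × ℕ // p.1 < p.2} := fun p => ⟨(p.1.1, p.1.2), p.2⟩
  have he : Function.Injective e := by
    intro p q h
    simp only [e, Subtype.mk.injEq, Prod.mk.injEq] at h
    exact Subtype.ext (Prod.ext (Fin.ext h.1) (Fin.ext h.2))
  have h := hg.indep.precomp he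
  rw [iIndepFun_iff_map_fun_eq_pi_map fun p => (hg.hasLaw _ _ (e p).2).aemeasurable] at h
  refine h.trans ?_
  congr 1
  funext p
  exact (hg.hasLaw _ _ (e p).2).map_eq

end Transfer

end QuantumSK

open QuantumSK in
theorem mainTheorem2 {Ω : Type*} [MeasurableSpace Ω] (P : Measure Ω) [IsProbabilityMeasure P]
    (g : ℕ → ℕ → Ω → ℝ) (hg : QuantumSK.IsGaussianDisorder P g)
    (β v b : ℝ) (hβ : 0 < β) (hv : 0 < v) (hb : 0 ≤ b)
    (hweak : 4 * QuantumSK.disorderParameter β v < 1) :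
    (∀ N : ℕ, 2 ≤ N →
      Integrable (fun ω => QuantumSK.partitionFunction β v b N (fun i j => g i j ω)) P) ∧
    Tendsto (fun N : ℕ => QuantumSK.annealedFreeEnergy P g β v b N) atTop
      (𝓝 (QuantumSK.macroscopicAnnealedFreeEnergy P g β v b)) ∧
    ∀ᵐ ω ∂P, Tendsto (fun N : ℕ => QuantumSK.freeEnergy β v b N (fun i j => g i j ω)) atTop
      (𝓝 (QuantumSK.macroscopicAnnealedFreeEnergy P g β v b)) := by
  have hZ : ∀ N ω, partitionFunction β v b N (fun i j => g i j ω) =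
      pairPartition β v b N fun p => g p.1.1 p.1.2 ω := fun N ω =>
    partitionFunction_eq_pairPartition hβ.le hb N v _
  have hcont := continuous_pairPartition hβ.le hv.le hb
  have hmean : ∀ N, ∫ ω, partitionFunction β v b N (fun i j => g i j ω) ∂P =
      meanPartition β v b N := fun N => by
    simp only [hZ]
    rw [meanPartition, ← hg.map_couplings N, integral_map (hg.aemeasurable_couplings N)
      (hcont N).aestronglyMeasurable]
  obtain ⟨L, hL⟩ := exists_tendsto_log_meanPartition_div hβ.le hv.le hb
  have hann : Tendsto (annealedFreeEnergy P g β v b) atTop (𝓝 (-(1 / β) * L)) := by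
    refine (hL.const_mul (-(1 / β))).congr fun N => ?_
    rw [annealedFreeEnergy, hmean, one_div, one_div, mul_inv]
    ring
  have hlim : macroscopicAnnealedFreeEnergy P g β v b = -(1 / β) * L := hann.limUnder_eq
  rw [hlim]
  refine ⟨fun N _ => ?_, hann, ?_⟩
  · have h : Integrable (pairPartition β v b N) (P.map fun ω (p : Pair N) => g p.1.1 p.1.2 ω) := by
      rw [hg.map_couplings N]
      simpa using integrable_pairPartition_pow hβ.le hv.le hb N 1
    simp only [hZ]
    exact h.comp_aemeasurable (hg.aemeasurable_couplings N)
  have hdev : ∀ᵐ ω ∂P, Tendsto (fun N : ℕ =>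
      (Real.log (pairPartition β v b N fun p => g p.1.1 p.1.2 ω) - meanLogPartition β v b N) / N)
      atTop (𝓝 0) := by
    refine ae_tendsto_zero_of_summable fun ε hε => ?_
    have hV : 0 < β * v := mul_pos hβ hv
    have hs := (summable_exp_neg_mul_nat (a := ε ^ 2 / (4 * (β * v) ^ 2))
      (by positivity)).mul_left 2
    refine Summable.of_norm_bounded_eventually_nat hs ?_
    filter_upwards [eventually_ne_atTop 0] with N hN
    have hN' : (0 : ℝ) < N := by positivity
    rw [Real.norm_of_nonneg measureReal_nonneg]
    refine le_trans (le_of_eq ?_) (measureReal_abs_log_sub_le hβ hv hb hε hN)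
    have hclosed : IsClosed {x : Pair N → ℝ | ε * N ≤
        |Real.log (pairPartition β v b N x) - meanLogPartition β v b N|} :=
      isClosed_le continuous_const ((continuous_of_abs_sub_le_sum
        (abs_log_pairPartition_sub_le hβ.le hv.le hb N)).sub continuous_const).abs
    rw [← hg.map_couplings N, map_measureReal_apply_of_aemeasurable (hg.aemeasurable_couplings N)
      hclosed.measurableSet]
    congr 1
    ext ω
    simp only [Set.mem_ofPred_eq, Set.mem_preimage, abs_div, Nat.abs_cast, le_div_iff₀ hN']
  filter_upwards [hdev] with ω hω
  have h := ((hω.add (tendsto_meanLogPartition_sub_div hβ hv hb hweak)).add hL).const_mul (-(1 / β))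
  rw [zero_add, zero_add] at h
  refine h.congr fun N => ?_
  rw [freeEnergy, hZ, one_div, one_div, mul_inv]
  ring
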